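/- Let $\mathbb H$ be the quaternions, $\mathbb B=\{q\in\mathbb H:|q|<1\}$, and let $\mathbb S$ be the set of purely imaginary quaternions $I$ with $|I|=1$. For $I\in\mathbb S$ let $\mathbb C_I=\{x+Iy:x,y\in\mathbb R\}$, identified with $\mathbb C$, let $\mathbb B_I=\mathbb B\cap\mathbb C_I$, and let $\lambda$ denote Lebesgue (area) measure on $\mathbb C_I$. A function $f:\mathbb B\to\mathbb H$ is slice regular if it is real differentiable and, for every $I\in\mathbb S$, $\frac12\left(\frac{\partial}{\partial x}+I\frac{\partial}{\partial y}\right)f(x+Iy)=0$ for $x+Iy\in\mathbb B_I$. For $p\in(0,\infty)$ the slice Bergman space $\mathcal A^p(\mathbb B)$ is the space of all slice regular $f$ on $\mathbb B$ with $$\|f\|_{\mathcal A^p}=\Big(\sup_{I\in\mathbb S}\int_{\mathbb B_I}|f|^p\,d\lambda\Big)^{1/p}<\infty .$$ A finite positive Borel measure $\mu$ on $\mathbb B$ is Carleson for $\mathcal A^p(\mathbb B)$ if there is a constant $C$ such that $\int_{\mathbb B}|f|^p\,d\mu\le C\,\|f\|_{\mathcal A^p}^p$ for all $f\in\mathcal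 A^p(\mathbb B)$. For $I\in\mathbb S$, $\alpha\in\mathbb B_I$ and $r\in(0,1)$ let $$\Delta_I(\alpha,r)=\Big\{z\in\mathbb B_I:\Big|\frac{z-\alpha}{1-z\bar\alpha}\Big|<r\Big\}$$ be the pseudohyperbolic disc in $\mathbb C_I$, let $|\Delta_I(\alpha,r)|$ be its area, and let $$\Delta(\alpha,r)=\{x+Jy: J\in\mathbb S,\ x,y\in\mathbb R,\ x+Iy\in\Delta_I(\alpha,r)\}$$ be its axially symmetric completion. **Theorem.** Let $p\in(0,\infty)$ be fixed and let $\mu$ be a finite positive Borel measure on $\mathbb B$. The following are equivalent: 1. $\mu$ is Carleson for $\mathcal A^p(\mathbb B)$. 2. For every $r\in(0,1)$ there is a constant $C_r$ such that $\mu(\Delta(\alpha,r))\le C_r\,|\Delta_I(\alpha,r)|$ for all $I\in\mathbb S$ and all $\alpha\in\mathbb B_I$. 3. For some $r\in(0,1)$ there is a constant $C_r$ such that $\mu(\Delta(\alpha,r))\le C_r\,|\Delta_I(\alpha,r)|$ for all $I\in\mathbb S$ and all $\alpha\in\mathbb B_I$. -/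

import Mathlib

open MeasureTheory
open scoped Quaternion ENNReal NNReal

namespace SliceBergman

/-- The sphere `𝕊` of imaginary units: purely imaginary quaternions of norm one. -/
def imagUnits : Set ℍ[ℝ] := {I | I.re = 0 ∧ ‖I‖ = 1}

/-- The open unit ball `𝔹` of the quaternions. -/
def unitBall : Set ℍ[ℝ] := {q | ‖q‖ < 1}

/-- The point `x + I y` of the slice `ℂ_I` that corresponds to `x + i y`. -/
noncomputable def slicePt (I : ℍ[ℝ]) (z : ℂ) : ℍ[ℝ] := (z.re : ℍ[ℝ]) + I * (z.im : ℍ[ℝ])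

/-- The complex plane `ℂ_I = ℝ + I ℝ` inside the quaternions. -/
def slicePlane (I : ℍ[ℝ]) : Set ℍ[ℝ] := Set.range (slicePt I)

/-- The disc `𝔹_I = 𝔹 ∩ ℂ_I`. -/
def sliceBall (I : ℍ[ℝ]) : Set ℍ[ℝ] := unitBall ∩ slicePlane I

/-- The operator `½ (∂/∂x + I ∂/∂y)` applied to the restriction of `f` to `ℂ_I`,
at the point `x + I y`. -/
noncomputable def dbar (I : ℍ[ℝ]) (f : ℍ[ℝ] → ℍ[ℝ]) (x y : ℝ) : ℍ[ℝ] :=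
  (1 / 2 : ℝ) • (deriv (fun t : ℝ => f (slicePt I ⟨t, y⟩)) x
    + I * deriv (fun t : ℝ => f (slicePt I ⟨x, t⟩)) y)

/-- (Left) slice regular functions on an open set `U`: real differentiable on `U`, and the
restriction to every slice `ℂ_I` satisfies the Cauchy-Riemann equation on `U ∩ ℂ_I`. -/
def SliceRegularOn (f : ℍ[ℝ] → ℍ[ℝ]) (U : Set ℍ[ℝ]) : Prop :=
  DifferentiableOn ℝ f U ∧
    ∀ I ∈ imagUnits, ∀ x y : ℝ, slicePt I ⟨x, y⟩ ∈ U → dbar I f x y = 0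

/-- Lebesgue (area) measure `λ` on the slice `ℂ_I`, as a measure on the quaternions:
the image of Lebesgue measure under `x + i y ↦ x + I y`. -/
noncomputable def sliceArea [MeasurableSpace ℍ[ℝ]] (I : ℍ[ℝ]) : Measure ℍ[ℝ] :=
  (volume : Measure ℂ).map (slicePt I)

/-- `‖f‖ = (sup_I ∫_{𝔹_I} |f|^p dλ)^{1/p}`, with value `∞` if the supremum is infinite. -/
noncomputable def bergmanNorm [MeasurableSpace ℍ[ℝ]] (p : ℝ) (f : ℍ[ℝ] → ℍ[ℝ]) : ℝ≥0∞ :=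
  (⨆ I ∈ imagUnits, ∫⁻ q in sliceBall I, ‖f q‖ₑ ^ p ∂(sliceArea I)) ^ (1 / p)

/-- Membership in the slice regular Bergman space `𝒜^p(𝔹)`. Only the values of `f` on `𝔹`
matter. -/
def MemBergman [MeasurableSpace ℍ[ℝ]] (p : ℝ) (f : ℍ[ℝ] → ℍ[ℝ]) : Prop :=
  SliceRegularOn f unitBall ∧
    (⨆ I ∈ imagUnits, ∫⁻ q in sliceBall I, ‖f q‖ₑ ^ p ∂(sliceArea I)) < ∞

/-- `μ` is a Carleson measure for `𝒜^p(𝔹)`. -/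
def IsCarleson [MeasurableSpace ℍ[ℝ]] (p : ℝ) (μ : Measure ℍ[ℝ]) : Prop :=
  ∃ C : ℝ≥0, ∀ f : ℍ[ℝ] → ℍ[ℝ], MemBergman p f →
    ∫⁻ q in unitBall, ‖f q‖ₑ ^ p ∂μ ≤ C * bergmanNorm p f ^ p

/-- The pseudohyperbolic distance `|(z - α) / (1 - z ᾱ)|` of points `z`, `α` of one slice disc. -/
noncomputable def rhoSlice (z α : ℍ[ℝ]) : ℝ := ‖(z - α) * (1 - z * star α)⁻¹‖

/-- The pseudohyperbolic disc `Δ_I(α, r)`. For `r < 1` a point `z` of `ℂ_I` with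
`|z - α| < r |1 - z ᾱ|` lies in `𝔹`; asking for `z ∈ 𝔹_I` keeps out the pole `z = 1 / ᾱ`,
where the quotient has no meaning. -/
def discSlice (I α : ℍ[ℝ]) (r : ℝ) : Set ℍ[ℝ] := {z | z ∈ sliceBall I ∧ rhoSlice z α < r}

/-- The axially symmetric completion `{x + J y : J ∈ 𝕊, x + I y ∈ A}` of a set `A ⊆ ℂ_I`. -/
def axialCompletion (I : ℍ[ℝ]) (A : Set ℍ[ℝ]) : Set ℍ[ℝ] :=
  {q | ∃ J ∈ imagUnits, ∃ z : ℂ, q = slicePt J z ∧ slicePt I z ∈ A}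

/-- `Δ(α, r)`, the axially symmetric completion of `Δ_I(α, r)`. -/
def tube (I α : ℍ[ℝ]) (r : ℝ) : Set ℍ[ℝ] := axialCompletion I (discSlice I α r)

/-- `μ(Δ(α, r)) ≤ C |Δ_I(α, r)|` for all `Δ_I(α, r)`, `α ∈ 𝔹_I`, with one constant `C` for
the given `r`. -/
def TubeBound [MeasurableSpace ℍ[ℝ]] (μ : Measure ℍ[ℝ]) (r : ℝ) : Prop :=
  ∃ C : ℝ≥0, ∀ I ∈ imagUnits, ∀ α ∈ sliceBall I,
    μ (tube I α r) ≤ C * sliceArea I (discSlice I α r)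

end SliceBergman

namespace SliceBergman

open ComplexConjugate Metric

/-! Write `δ = 1 - ‖a‖`. The disc of pseudohyperbolic radius `r` about `a` lies between Euclidean
discs about `a` with radii comparable to `δ`, so its area is comparable to `δ ^ 2`.

Tube bound implies Carleson: `SliceRegularOn.norm_slicePt_le` controls `f` at any point by its
values at two conjugate points of one fixed slice. There `‖f‖ ^ p` is dominated by its averages over
discs of radius `r * δ` (`exists_areaSubmean_rpow`). Integrating against `μ` and exchanging the
integrals leaves, for each `w` of the disc, the measure of the tube about `w` divided by a multiple
of `(1 - ‖w‖) ^ 2`, which the hypothesis bounds (`lintegral_comp_le_of_tubeBound`).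

Carleson implies tube bound: a test function must be large on the whole tube, hence on all slices at
once. The kernel `((1 - z a)(1 - z ā))⁻ᴺ` has real coefficients, so its modulus is the same on every
slice. With `E = ‖1 - a * a‖` and `s = N p > 2`, its norm to the power `p` is at most a constant
times `E ^ (-s) * δ ^ (2 - s)` (`exists_lintegral_symmKernel_le`), and on the tube its modulus to
the power `p` is at least a constant times `(E δ) ^ (-s)` (`norm_symm_le_of_pseudohyperbolic`). The
factor `E` cancels in the quotient and `δ ^ 2` remains. -/

/-! ### Slices as isometric copies of the complex plane -/

theorem imagUnits_mul_self {I : ℍ[ℝ]} (hI : I ∈ imagUnits) : I * I = -1 := by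
  have h1 : star I = -I := Quaternion.star_eq_neg.2 hI.1
  have h2 := Quaternion.self_mul_star I
  rw [h1, Quaternion.normSq_eq_norm_mul_self, hI.2] at h2
  have h3 : I * I = -(I * -I) := by simp
  rw [h3, h2]; simp

theorem neg_mem_imagUnits {I : ℍ[ℝ]} (hI : I ∈ imagUnits) : -I ∈ imagUnits := by
  refine ⟨?_, ?_⟩
  · simp [hI.1]
  · rw [norm_neg]; exact hI.2

/-- The algebra embedding of `ℂ` onto the slice `ℂ_I`. -/
noncomputable def sliceHom {I : ℍ[ℝ]} (hI : I ∈ imagUnits) : ℂ →ₐ[ℝ] ℍ[ℝ] :=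
  Complex.lift ⟨I, imagUnits_mul_self hI⟩

theorem sliceHom_apply {I : ℍ[ℝ]} (hI : I ∈ imagUnits) (z : ℂ) :
    sliceHom hI z = slicePt I z := by
  simp only [sliceHom, Complex.lift_apply, Complex.liftAux_apply, slicePt]
  congr 1
  rw [← Quaternion.coe_commutes, Quaternion.coe_mul_eq_smul]

theorem norm_slicePt {I : ℍ[ℝ]} (hI : I ∈ imagUnits) (z : ℂ) : ‖slicePt I z‖ = ‖z‖ := by
  have h : ‖slicePt I z‖ * ‖slicePt I z‖ = ‖z‖ ^ 2 := by
    rw [← Quaternion.normSq_eq_norm_mul_self, ← Complex.normSq_eq_norm_sq,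
      Complex.normSq_apply, Quaternion.normSq_def']
    have h1 : Quaternion.normSq I = 1 := by
      rw [Quaternion.normSq_eq_norm_mul_self, hI.2]; norm_num
    rw [Quaternion.normSq_def'] at h1
    have h0 := hI.1
    simp only [slicePt, Quaternion.re_add, Quaternion.re_mul, Quaternion.re_coe,
      Quaternion.imI_coe, Quaternion.imJ_coe, Quaternion.imK_coe, Quaternion.imI_add,
      Quaternion.imJ_add, Quaternion.imK_add, Quaternion.imI_mul, Quaternion.imJ_mul,
      Quaternion.imK_mul, h0]
    rw [h0] at h1
    linear_combination z.im ^ 2 * h1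
  rw [← sq] at h
  exact (sq_eq_sq₀ (norm_nonneg _) (norm_nonneg _)).1 h

/-- The embedding of `ℂ` onto the slice `ℂ_I` as a linear isometry. -/
noncomputable def sliceIsometry {I : ℍ[ℝ]} (hI : I ∈ imagUnits) : ℂ →ₗᵢ[ℝ] ℍ[ℝ] where
  toLinearMap := (sliceHom hI).toLinearMap
  norm_map' z := by simpa [sliceHom_apply] using norm_slicePt hI z

theorem sliceIsometry_apply {I : ℍ[ℝ]} (hI : I ∈ imagUnits) (z : ℂ) :
    sliceIsometry hI z = slicePt I z := sliceHom_apply hI z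

theorem slicePt_isometry {I : ℍ[ℝ]} (hI : I ∈ imagUnits) : Isometry (slicePt I) := by
  have := (sliceIsometry hI).isometry
  rwa [show ⇑(sliceIsometry hI) = slicePt I from funext (sliceIsometry_apply hI)] at this

theorem hasFDerivAt_slicePt {I : ℍ[ℝ]} (hI : I ∈ imagUnits) (z : ℂ) :
    HasFDerivAt (slicePt I) (sliceIsometry hI).toContinuousLinearMap z := by
  have := (sliceIsometry hI).toContinuousLinearMap.hasFDerivAt (x := z)
  rwa [show ⇑(sliceIsometry hI).toContinuousLinearMap = slicePt I from
    funext (sliceIsometry_apply hI)] at this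

theorem slicePt_mem_unitBall {I : ℍ[ℝ]} (hI : I ∈ imagUnits) (z : ℂ) :
    slicePt I z ∈ unitBall ↔ ‖z‖ < 1 := by
  rw [unitBall, Set.mem_ofPred_eq, norm_slicePt hI]

theorem isOpen_unitBall : IsOpen unitBall := isOpen_lt continuous_norm continuous_const

theorem slicePt_neg_conj (I : ℍ[ℝ]) (z : ℂ) : slicePt (-I) (conj z) = slicePt I z := by
  simp [slicePt]

theorem exists_slicePt (q : ℍ[ℝ]) : ∃ J ∈ imagUnits, q = slicePt J ⟨q.re, ‖q.im‖⟩ := by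
  by_cases h : q.im = 0
  -- A real quaternion lies on every slice, so any imaginary unit serves.
  · obtain ⟨e, he⟩ : ∃ e : ℍ[ℝ], e = ⟨0, 1, 0, 0⟩ := ⟨_, rfl⟩
    refine ⟨e, ⟨by rw [he], ?_⟩, ?_⟩
    · have : ‖e‖ * ‖e‖ = 1 := by
        rw [← Quaternion.normSq_eq_norm_mul_self, Quaternion.normSq_def', he]; norm_num
      nlinarith [norm_nonneg e]
    · simp only [slicePt, h, norm_zero, Quaternion.coe_zero, mul_zero, add_zero]
      conv_lhs => rw [← Quaternion.re_add_im q, h, add_zero]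
  · have hn : ‖q.im‖ ≠ 0 := norm_ne_zero_iff.2 h
    refine ⟨‖q.im‖⁻¹ • q.im, ⟨by simp, ?_⟩, ?_⟩
    · rw [norm_smul, norm_inv, norm_norm, inv_mul_cancel₀ hn]
    · simp only [slicePt]
      rw [← Quaternion.coe_commutes, Quaternion.coe_mul_eq_smul, smul_smul, mul_inv_cancel₀ hn,
        one_smul, Quaternion.re_add_im]

/-- The second representative is needed because the representation formula involves both `z` and its
conjugate. -/
theorem exists_slicePt_conj (q : ℍ[ℝ]) : ∃ J ∈ imagUnits, q = slicePt J ⟨q.re, -‖q.im‖⟩ := by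
  obtain ⟨J, hJ, h⟩ := exists_slicePt q
  refine ⟨-J, neg_mem_imagUnits hJ, h.trans ?_⟩
  rw [← slicePt_neg_conj]
  rfl

theorem mem_sliceBall {I : ℍ[ℝ]} (hI : I ∈ imagUnits) {q : ℍ[ℝ]} :
    q ∈ sliceBall I ↔ ∃ z : ℂ, ‖z‖ < 1 ∧ slicePt I z = q := by
  constructor
  · rintro ⟨h1, z, rfl⟩
    exact ⟨z, (slicePt_mem_unitBall hI z).1 h1, rfl⟩
  · rintro ⟨z, h, rfl⟩
    exact ⟨(slicePt_mem_unitBall hI z).2 h, z, rfl⟩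

theorem slicePt_mem_sliceBall {I : ℍ[ℝ]} (hI : I ∈ imagUnits) (z : ℂ) :
    slicePt I z ∈ sliceBall I ↔ ‖z‖ < 1 := by
  rw [sliceBall, Set.mem_inter_iff, slicePt_mem_unitBall hI]
  exact and_iff_left ⟨z, rfl⟩

theorem star_slicePt {I : ℍ[ℝ]} (hI : I ∈ imagUnits) (z : ℂ) :
    star (slicePt I z) = slicePt I (conj z) := by
  have h1 : star I = -I := Quaternion.star_eq_neg.2 hI.1
  simp only [slicePt, star_add, star_mul, h1, Quaternion.star_coe, Complex.conj_re,
    Complex.conj_im]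
  rw [Quaternion.coe_neg, mul_neg, mul_neg, Quaternion.coe_commutes]

/-! ### Pseudohyperbolic discs, tubes and their areas -/

theorem rhoSlice_slicePt {I : ℍ[ℝ]} (hI : I ∈ imagUnits) (z a : ℂ) :
    rhoSlice (slicePt I z) (slicePt I a) = ‖z - a‖ / ‖1 - z * conj a‖ := by
  rw [rhoSlice, star_slicePt hI]
  simp only [← sliceHom_apply hI]
  rw [← map_sub, ← map_mul, ← map_one (sliceHom hI), ← map_sub, ← map_inv₀, ← map_mul,
    sliceHom_apply, norm_slicePt hI, norm_mul, norm_inv, div_eq_mul_inv]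

theorem slicePt_mem_discSlice {I : ℍ[ℝ]} (hI : I ∈ imagUnits) {z a : ℂ} {r : ℝ} :
    slicePt I z ∈ discSlice I (slicePt I a) r ↔
      ‖z‖ < 1 ∧ ‖z - a‖ / ‖1 - z * conj a‖ < r := by
  rw [discSlice, Set.mem_ofPred_eq, slicePt_mem_sliceBall hI, rhoSlice_slicePt hI]

theorem one_sub_norm_le_norm_one_sub_mul {a z : ℂ} (hz : ‖z‖ ≤ 1) :
    1 - ‖a‖ ≤ ‖1 - z * a‖ := by
  have h1 := norm_sub_norm_le (1 : ℂ) (z * a)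
  rw [norm_one, norm_mul] at h1
  nlinarith [norm_nonneg a]

/-- If moreover `‖z - a‖ < r * ‖1 - z * conj a‖`, the last term can be absorbed, which gives `‖1 - z
* conj a‖ ≤ (1 - ‖a‖ ^ 2) / (1 - r)`. -/
theorem norm_one_sub_mul_conj_le {a z : ℂ} (ha : ‖a‖ < 1) :
    ‖1 - z * conj a‖ ≤ (1 - ‖a‖ ^ 2) + ‖z - a‖ := by
  have hc : ‖conj a‖ = ‖a‖ := RCLike.norm_conj a
  have e : 1 - z * conj a = ((1 - ‖a‖ ^ 2 : ℝ) : ℂ) - (z - a) * conj a := by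
    push_cast
    rw [← Complex.mul_conj']; ring
  rw [e]
  refine (norm_sub_le _ _).trans ?_
  rw [Complex.norm_real, Real.norm_of_nonneg (by nlinarith [norm_nonneg a]), norm_mul, hc]
  nlinarith [norm_nonneg (z - a)]

theorem slicePt_mem_tube {I J : ℍ[ℝ]} (hI : I ∈ imagUnits) (hJ : J ∈ imagUnits) {z a : ℂ}
    {r : ℝ} (hz : ‖z‖ < 1) (ha : ‖a‖ < 1) (h : ‖z - a‖ < r * ‖1 - z * conj a‖) :
    slicePt J z ∈ tube I (slicePt I a) r := by
  refine ⟨J, hJ, z, rfl, (slicePt_mem_discSlice hI).2 ⟨hz, ?_⟩⟩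
  have : 0 < ‖1 - z * conj a‖ := by
    have := one_sub_norm_le_norm_one_sub_mul (a := conj a) hz.le
    rw [RCLike.norm_conj] at this
    linarith
  rwa [div_lt_iff₀ this]

theorem exists_of_mem_tube {I : ℍ[ℝ]} (hI : I ∈ imagUnits) {a : ℂ} {r : ℝ} (ha : ‖a‖ < 1)
    {q : ℍ[ℝ]} (h : q ∈ tube I (slicePt I a) r) :
    ∃ J ∈ imagUnits, ∃ z : ℂ, q = slicePt J z ∧ ‖z‖ < 1 ∧
      ‖z - a‖ < r * ‖1 - z * conj a‖ := by
  obtain ⟨J, hJ, z, rfl, h2⟩ := h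
  obtain ⟨hz, h3⟩ := (slicePt_mem_discSlice hI).1 h2
  refine ⟨J, hJ, z, rfl, hz, ?_⟩
  have : 0 < ‖1 - z * conj a‖ := by
    have := one_sub_norm_le_norm_one_sub_mul (a := conj a) hz.le
    rw [RCLike.norm_conj] at this
    linarith
  rwa [div_lt_iff₀ this] at h3

section Area

variable [MeasurableSpace ℍ[ℝ]] [BorelSpace ℍ[ℝ]]

theorem measurableEmbedding_slicePt {I : ℍ[ℝ]} (hI : I ∈ imagUnits) :
    MeasurableEmbedding (slicePt I) :=
  (slicePt_isometry hI).isClosedEmbedding.measurableEmbedding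

theorem setLIntegral_sliceBall {I : ℍ[ℝ]} (hI : I ∈ imagUnits) (g : ℍ[ℝ] → ℝ≥0∞) :
    ∫⁻ q in sliceBall I, g q ∂(sliceArea I) = ∫⁻ z in Metric.ball (0 : ℂ) 1, g (slicePt I z) := by
  rw [sliceArea, (measurableEmbedding_slicePt hI).restrict_map,
    (measurableEmbedding_slicePt hI).lintegral_map]
  congr 2
  ext z
  simp [slicePt_mem_sliceBall hI]

theorem sliceArea_discSlice {I : ℍ[ℝ]} (hI : I ∈ imagUnits) (a : ℂ) (r : ℝ) :
    sliceArea I (discSlice I (slicePt I a) r) =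
      volume {z : ℂ | ‖z‖ < 1 ∧ ‖z - a‖ / ‖1 - z * conj a‖ < r} := by
  rw [sliceArea, (measurableEmbedding_slicePt hI).map_apply]
  congr 1
  ext z
  exact slicePt_mem_discSlice hI

/-- In the disc, `‖z - a‖ < r (1 - ‖a‖ ^ 2) + r ‖z - a‖`, and `1 - ‖a‖ ^ 2 ≤ 2 (1 - ‖a‖)`; hence the
Euclidean radius. -/
theorem sliceArea_discSlice_le {I : ℍ[ℝ]} (hI : I ∈ imagUnits) {a : ℂ} {r : ℝ} (ha : ‖a‖ < 1)
    (hr : r ∈ Set.Ioo (0 : ℝ) 1) :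
    sliceArea I (discSlice I (slicePt I a) r) ≤
      ENNReal.ofReal (2 * r / (1 - r) * (1 - ‖a‖)) ^ 2 * NNReal.pi := by
  rw [sliceArea_discSlice hI, ← Complex.volume_ball a]
  refine measure_mono fun z hz => ?_
  obtain ⟨hz, h⟩ := hz
  have hc : ‖conj a‖ = ‖a‖ := RCLike.norm_conj a
  have h0 := one_sub_norm_le_norm_one_sub_mul (a := conj a) hz.le
  rw [hc] at h0
  rw [div_lt_iff₀ (by linarith)] at h
  have h1 := norm_one_sub_mul_conj_le (z := z) ha
  rw [Metric.mem_ball, dist_eq_norm, div_mul_eq_mul_div, lt_div_iff₀ (by linarith [hr.2])]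
  have h2 := mul_le_mul_of_nonneg_left h1 hr.1.le
  nlinarith [hr.1, hr.2, norm_nonneg a, mul_nonneg hr.1.le (sq_nonneg (1 - ‖a‖))]

theorem le_sliceArea_discSlice {I : ℍ[ℝ]} (hI : I ∈ imagUnits) {a : ℂ} {r : ℝ} (ha : ‖a‖ < 1)
    (hr : r ∈ Set.Ioo (0 : ℝ) 1) :
    ENNReal.ofReal (r * (1 - ‖a‖)) ^ 2 * NNReal.pi ≤
      sliceArea I (discSlice I (slicePt I a) r) := by
  rw [sliceArea_discSlice hI, ← Complex.volume_ball a]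
  refine measure_mono fun z hz => ?_
  rw [Metric.mem_ball, dist_eq_norm] at hz
  have hz1 : ‖z‖ < 1 := by
    have := norm_le_norm_add_norm_sub' z a
    nlinarith [hr.1, hr.2]
  have h0 := one_sub_norm_le_norm_one_sub_mul (a := conj a) hz1.le
  rw [RCLike.norm_conj a] at h0
  refine ⟨hz1, ?_⟩
  rw [div_lt_iff₀ (by linarith)]
  exact hz.trans_le (mul_le_mul_of_nonneg_left h0 hr.1.le)

end Area

/-! ### Mean value inequality over planar discs -/

theorem measurable_indicator_of_continuousOn {X Y : Type*} [TopologicalSpace X]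
    [MeasurableSpace X] [BorelSpace X] [TopologicalSpace Y] [MeasurableSpace Y] [BorelSpace Y]
    [Zero Y] {s : Set X} {g : X → Y} (hg : ContinuousOn g s) (hs : MeasurableSet s) :
    Measurable (s.indicator g) := by
  classical
  rw [← Set.piecewise_eq_indicator]
  exact hg.measurable_piecewise continuousOn_const hs

theorem lintegral_Ioo_ofReal {R : ℝ} (hR : 0 ≤ R) :
    ∫⁻ r in Set.Ioo 0 R, ENNReal.ofReal r = ENNReal.ofReal (R ^ 2 / 2) := by
  rw [restrict_Ioo_eq_restrict_Ioc, ← ofReal_integral_eq_lintegral_ofReal,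
    ← intervalIntegral.integral_of_le hR, integral_id]
  · simp
  · exact (continuous_id.intervalIntegrable 0 R).1
  · exact (ae_restrict_iff' measurableSet_Ioc).2 (.of_forall fun x hx => hx.1.le)

theorem enorm_le_lintegral_circle {F : ℂ → ℂ} {a : ℂ} {R r : ℝ}
    (hF : DifferentiableOn ℂ F (ball a R)) (hr : 0 < r) (hrR : r < R) :
    ENNReal.ofReal (2 * Real.pi) * ‖F a‖ₑ ≤
      ∫⁻ θ in Set.Ioo (-Real.pi) Real.pi, ‖F (circleMap a r θ)‖ₑ := by
  have h1 : Real.circleAverage F a r = F a := by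
    refine DiffContOnCl.circleAverage ?_
    rw [abs_of_pos hr]
    exact (hF.mono (closure_ball_subset_closedBall.trans
      (closedBall_subset_ball hrR))).diffContOnCl
  -- The period is moved to the angular range used by polar coordinates.
  have h2 : ∫ θ in (0 : ℝ)..2 * Real.pi, F (circleMap a r θ) =
      ∫ θ in Set.Ioo (-Real.pi) Real.pi, F (circleMap a r θ) := by
    have := ((periodic_circleMap a r).comp F).intervalIntegral_add_eq 0 (-Real.pi)
    simp only [Function.comp_def, zero_add] at this
    rw [this, show -Real.pi + 2 * Real.pi = Real.pi by ring,
      intervalIntegral.integral_of_le (by linarith [Real.pi_pos]), restrict_Ioo_eq_restrict_Ioc]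
  have h3 : F a * (2 * Real.pi : ℝ) = ∫ θ in Set.Ioo (-Real.pi) Real.pi, F (circleMap a r θ) := by
    rw [← h2, ← h1, Real.circleAverage, Complex.real_smul]
    have : ((2 * Real.pi : ℝ) : ℂ) ≠ 0 := by
      exact_mod_cast (by positivity : (2 * Real.pi : ℝ) ≠ 0)
    push_cast at this ⊢
    field_simp
  calc ENNReal.ofReal (2 * Real.pi) * ‖F a‖ₑ = ‖F a * (2 * Real.pi : ℝ)‖ₑ := by
        rw [enorm_mul, mul_comm, ← ofReal_norm ((2 * Real.pi : ℝ) : ℂ), Complex.norm_real,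
          Real.norm_of_nonneg (by positivity)]
    _ ≤ _ := by rw [h3]; exact enorm_integral_le_lintegral_enorm _

/-- The area form of the mean value inequality. -/
theorem enorm_le_lintegral_ball {F : ℂ → ℂ} {a : ℂ} {R : ℝ} (hR : 0 ≤ R)
    (hF : DifferentiableOn ℂ F (ball a R)) :
    ENNReal.ofReal (Real.pi * R ^ 2) * ‖F a‖ₑ ≤ ∫⁻ z in ball a R, ‖F z‖ₑ := by
  -- Extension by zero, so that translation and polar coordinates can be used on the whole plane.
  set h : ℂ → ℝ≥0∞ := (ball a R).indicator fun z => ‖F z‖ₑ with hh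
  have hm : Measurable h :=
    measurable_indicator_of_continuousOn hF.continuousOn.enorm measurableSet_ball
  have hc : ∀ r θ : ℝ, a + Complex.polarCoord.symm (r, θ) = circleMap a r θ := by
    intro r θ
    rw [Complex.polarCoord_symm_apply, circleMap, Complex.exp_mul_I]
    push_cast; rfl
  have h1 : ∀ r ∈ Set.Ioo 0 R, ENNReal.ofReal r * (ENNReal.ofReal (2 * Real.pi) * ‖F a‖ₑ) ≤
      ∫⁻ θ in Set.Ioo (-Real.pi) Real.pi,
        ENNReal.ofReal r • h (a + Complex.polarCoord.symm (r, θ)) := by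
    intro r hr
    simp only [smul_eq_mul, hc]
    rw [lintegral_const_mul _ (by fun_prop)]
    gcongr
    refine (enorm_le_lintegral_circle hF hr.1 hr.2).trans (le_of_eq ?_)
    refine lintegral_congr fun θ => ?_
    rw [hh, Set.indicator_of_mem]
    rw [mem_ball, dist_eq_norm, circleMap_sub_center, norm_circleMap_zero, abs_of_pos hr.1]
    exact hr.2
  rw [← lintegral_indicator measurableSet_ball, ← hh, ← lintegral_add_left_eq_self h a,
    ← Complex.lintegral_comp_polarCoord_symm, polarCoord_target, Measure.volume_eq_prod,
    ← Measure.prod_restrict, lintegral_prod]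
  · calc ENNReal.ofReal (Real.pi * R ^ 2) * ‖F a‖ₑ
        = ∫⁻ r in Set.Ioo 0 R, ENNReal.ofReal r * (ENNReal.ofReal (2 * Real.pi) * ‖F a‖ₑ) := by
          rw [lintegral_mul_const _ (by fun_prop), lintegral_Ioo_ofReal hR, ← mul_assoc,
            ← ENNReal.ofReal_mul (by positivity)]
          congr 2; ring
      _ ≤ _ := setLIntegral_mono' measurableSet_Ioo h1
      _ ≤ _ := lintegral_mono_set Set.Ioo_subset_Ioi_self
  · have : Continuous fun p : ℝ × ℝ => a + Complex.polarCoord.symm p := by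
      simp only [Complex.polarCoord_symm_apply]
      fun_prop
    exact (Measurable.mul (by fun_prop) (hm.comp this.measurable)).aemeasurable

/-! ### Forelli-Rudin estimate -/

/-- A form of the Forelli-Rudin estimate. -/
theorem lintegral_add_norm_rpow_neg {s δ : ℝ} (hδ : 0 < δ) :
    ∫⁻ w : ℂ, ENNReal.ofReal ((δ + ‖w‖) ^ (-s)) =
      ENNReal.ofReal (δ ^ (2 - s)) * ∫⁻ w : ℂ, ENNReal.ofReal ((1 + ‖w‖) ^ (-s)) := by
  -- Scaling by `δ`: the integrand contributes `δ ^ (-s)` and the Jacobian `δ ^ 2`.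
  have h1 : ∀ w : ℂ, ENNReal.ofReal ((δ + ‖w‖) ^ (-s)) =
      ENNReal.ofReal (δ ^ (-s)) * ENNReal.ofReal ((1 + ‖δ⁻¹ • w‖) ^ (-s)) := by
    intro w
    rw [← ENNReal.ofReal_mul (by positivity), ← Real.mul_rpow hδ.le (by positivity), norm_smul,
      norm_inv, Real.norm_of_nonneg hδ.le]
    congr 2
    field_simp
  have hm : Measurable fun w : ℂ => ENNReal.ofReal ((1 + ‖w‖) ^ (-s)) := by fun_prop
  have h2 := lintegral_map (μ := volume) hm (measurable_const_smul (δ⁻¹ : ℝ))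
  rw [Measure.map_addHaar_smul volume (inv_ne_zero hδ.ne'), lintegral_smul_measure] at h2
  simp_rw [h1]
  rw [lintegral_const_mul _ (by fun_prop), ← h2, Complex.finrank_real_complex, smul_eq_mul,
    ← mul_assoc, ← ENNReal.ofReal_mul (by positivity)]
  congr 2
  rw [inv_pow, inv_inv, abs_of_pos (by positivity), ← Real.rpow_natCast, ← Real.rpow_add hδ]
  congr 1
  push_cast; ring

/-- With `u` unimodular and `u a = ‖a‖`, the quantity `‖1 - z a‖` is at least a third of `δ + ‖z -
u‖`. The integral over the disc is then dominated by a planar integral that scales in `δ` and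
converges because `s > 2`. -/
theorem exists_lintegral_norm_one_sub_mul_rpow_le {s : ℝ} (hs : 2 < s) :
    ∃ K : ℝ≥0, ∀ a : ℂ, ‖a‖ < 1 →
      ∫⁻ z in ball (0 : ℂ) 1, ENNReal.ofReal (‖1 - z * a‖ ^ (-s)) ≤
        K * ENNReal.ofReal ((1 - ‖a‖) ^ (2 - s)) := by
  have hfin : ∫⁻ w : ℂ, ENNReal.ofReal ((1 + ‖w‖) ^ (-s)) < ∞ :=
    finite_integral_one_add_norm (by rw [Complex.finrank_real_complex]; exact_mod_cast hs)
  lift ∫⁻ w : ℂ, ENNReal.ofReal ((1 + ‖w‖) ^ (-s)) to ℝ≥0 using hfin.ne with K₀ hK₀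
  refine ⟨Real.toNNReal (3 ^ s) * K₀, fun a ha => ?_⟩
  obtain ⟨u, hu, hua⟩ : ∃ u : ℂ, ‖u‖ = 1 ∧ (‖a‖ : ℂ) = u * a := by
    by_cases h : a = 0
    · exact ⟨1, by simp, by simp [h]⟩
    · have hn : ‖a‖ ≠ 0 := norm_ne_zero_iff.2 h
      refine ⟨‖a‖ / a, by simp [hn], by field_simp⟩
  set δ := 1 - ‖a‖ with hδ
  have hδ0 : 0 < δ := by linarith
  have key : ∀ z ∈ ball (0 : ℂ) 1, ENNReal.ofReal (‖1 - z * a‖ ^ (-s)) ≤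
      ENNReal.ofReal (3 ^ s) * ENNReal.ofReal ((δ + ‖z + -u‖) ^ (-s)) := by
    intro z hz
    rw [mem_ball_zero_iff] at hz
    have h0 := one_sub_norm_le_norm_one_sub_mul (a := a) hz.le
    have e : ‖1 - z * a‖ = ‖u - z * ‖a‖‖ := by
      rw [hua, show u - z * (u * a) = u * (1 - z * a) by ring, norm_mul, hu, one_mul]
    have h1 : ‖z + -u‖ ≤ ‖u - z * ‖a‖‖ + δ := by
      have : z + -u = z * (δ : ℂ) - (u - z * ‖a‖) := by rw [hδ]; push_cast; ring
      rw [this]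
      refine (norm_sub_le _ _).trans ?_
      rw [norm_mul, Complex.norm_real, Real.norm_of_nonneg hδ0.le]
      nlinarith
    -- Two copies of `δ` and one of `‖1 - z a‖`, each at most `‖1 - z a‖`, make the factor 3.
    have h2 : (δ + ‖z + -u‖) / 3 ≤ ‖1 - z * a‖ := by rw [e] at h0 ⊢; linarith
    rw [← ENNReal.ofReal_mul (by positivity)]
    refine ENNReal.ofReal_le_ofReal ?_
    have h3 := Real.rpow_le_rpow_of_nonpos (by positivity) h2 (by linarith : -s ≤ 0)
    rw [Real.div_rpow (by positivity) (by positivity), Real.rpow_neg (by positivity : (0:ℝ) ≤ 3),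
      div_inv_eq_mul] at h3
    rwa [mul_comm _ ((3 : ℝ) ^ s)] at h3
  calc _ ≤ ∫⁻ z in ball (0 : ℂ) 1,
          ENNReal.ofReal (3 ^ s) * ENNReal.ofReal ((δ + ‖z + -u‖) ^ (-s)) :=
        setLIntegral_mono' measurableSet_ball key
    _ ≤ ∫⁻ z : ℂ, ENNReal.ofReal (3 ^ s) * ENNReal.ofReal ((δ + ‖z + -u‖) ^ (-s)) :=
        setLIntegral_le_lintegral _ _
    _ = _ := by
        rw [lintegral_const_mul _ (by fun_prop),
          lintegral_add_right_eq_self (fun z : ℂ => ENNReal.ofReal ((δ + ‖z‖) ^ (-s))) (-u),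
          lintegral_add_norm_rpow_neg hδ0, ← hK₀, ENNReal.coe_mul, mul_assoc,
          mul_comm (K₀ : ℝ≥0∞)]
        rfl

/-! ### Sub-mean value inequality for powers -/

theorem volume_ball_eq_ofReal (a : ℂ) {R : ℝ} (hR : 0 ≤ R) :
    volume (ball a R) = ENNReal.ofReal (Real.pi * R ^ 2) := by
  rw [Complex.volume_ball, mul_comm, ENNReal.ofReal_mul Real.pi_pos.le, ENNReal.ofReal_pow hR]
  congr 1
  rw [← NNReal.coe_real_pi, ENNReal.ofReal_coe_nnreal]

/-- The area mean value inequality for a function on the disc `ball a R`. -/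
def AreaSubmean (u : ℂ → ℝ) (a : ℂ) (R : ℝ) : Prop :=
  ∀ z ρ, 0 ≤ ρ → ball z ρ ⊆ ball a R →
    ENNReal.ofReal (Real.pi * ρ ^ 2) * ENNReal.ofReal (u z) ≤
      ∫⁻ w in ball z ρ, ENNReal.ofReal (u w)

/-- Cut at height `l = u a / 2`. Values below `l` account for at most half of the mean; above `l`,
`u ≤ l ^ (1 - p) * u ^ p`. This replaces Jensen's inequality. -/
theorem AreaSubmean.rpow_of_one_le {p : ℝ} (hp : 1 ≤ p) {u : ℂ → ℝ} {a : ℂ} {R : ℝ} (hR : 0 < R)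
    (hu : ∀ z, 0 ≤ u z) (h : AreaSubmean u a R) :
    ENNReal.ofReal (R ^ 2) * ENNReal.ofReal (u a ^ p) ≤
      ENNReal.ofReal (2 ^ p / Real.pi) * ∫⁻ w in ball a R, ENNReal.ofReal (u w ^ p) := by
  have hpi := Real.pi_pos
  rcases (hu a).eq_or_lt with h0 | h0
  · rw [← h0, Real.zero_rpow (by linarith)]; simp
  by_cases hA : ∫⁻ w in ball a R, ENNReal.ofReal (u w ^ p) = ∞
  · rw [hA, ENNReal.mul_top]
    · exact le_top
    · simpa using (by positivity : 0 < (2 : ℝ) ^ p / Real.pi)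
  set l := u a / 2 with hl
  have hl0 : 0 < l := by positivity
  have hpt : ∀ w, u w ≤ l + l ^ (1 - p) * u w ^ p := by
    intro w
    rcases le_total (u w) l with hw | hw
    · have : 0 ≤ l ^ (1 - p) * u w ^ p := mul_nonneg (by positivity) (Real.rpow_nonneg (hu w) _)
      linarith
    · have hw0 : 0 < u w := hl0.trans_le hw
      have h1 : u w ^ (1 - p) ≤ l ^ (1 - p) :=
        Real.rpow_le_rpow_of_nonpos hl0 hw (by linarith)
      have h2 : u w ^ (1 - p) * u w ^ p = u w := by
        rw [← Real.rpow_add hw0]; simp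
      have h3 := mul_le_mul_of_nonneg_right h1 (Real.rpow_nonneg hw0.le p)
      linarith
  have h1 : ENNReal.ofReal (Real.pi * R ^ 2) * ENNReal.ofReal (u a) ≤
      ENNReal.ofReal (Real.pi * R ^ 2) * ENNReal.ofReal l +
        ENNReal.ofReal (l ^ (1 - p)) * ∫⁻ w in ball a R, ENNReal.ofReal (u w ^ p) := by
    refine (h a R hR.le subset_rfl).trans ?_
    calc _ ≤ ∫⁻ w in ball a R, (ENNReal.ofReal l +
            ENNReal.ofReal (l ^ (1 - p)) * ENNReal.ofReal (u w ^ p)) := by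
          refine lintegral_mono fun w => ?_
          rw [← ENNReal.ofReal_mul (by positivity), ← ENNReal.ofReal_add hl0.le
            (mul_nonneg (by positivity) (Real.rpow_nonneg (hu w) _))]
          exact ENNReal.ofReal_le_ofReal (hpt w)
      _ = _ := by
          rw [lintegral_add_left measurable_const, lintegral_const_mul' _ _ ENNReal.ofReal_ne_top,
            setLIntegral_const, volume_ball_eq_ofReal a hR.le, mul_comm (ENNReal.ofReal l)]
  obtain ⟨A, hA'⟩ : ∃ A : ℝ≥0, (A : ℝ≥0∞) = ∫⁻ w in ball a R, ENNReal.ofReal (u w ^ p) :=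
    ⟨_, ENNReal.coe_toNNReal hA⟩
  rw [← hA'] at h1 ⊢
  rw [← ENNReal.ofReal_coe_nnreal (p := A)] at h1 ⊢
  rw [← ENNReal.ofReal_mul (by positivity), ← ENNReal.ofReal_mul (by positivity),
    ← ENNReal.ofReal_mul (by positivity), ← ENNReal.ofReal_add (by positivity) (by positivity),
    ENNReal.ofReal_le_ofReal_iff (by positivity)] at h1
  rw [← ENNReal.ofReal_mul (by positivity), ← ENNReal.ofReal_mul (by positivity)]
  refine ENNReal.ofReal_le_ofReal ?_
  have h2 : Real.pi * R ^ 2 * l ≤ l ^ (1 - p) * A := by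
    have : u a = 2 * l := by rw [hl]; ring
    rw [this] at h1; linarith
  have h3 : Real.pi * R ^ 2 * l ^ p ≤ A := by
    have h4 := mul_le_mul_of_nonneg_right h2 (by positivity : 0 ≤ l ^ (p - 1))
    have e1 : l ^ (1 - p) * l ^ (p - 1) = 1 := by rw [← Real.rpow_add hl0]; simp
    have e2 : l * l ^ (p - 1) = l ^ p := by
      rw [← Real.rpow_one_add' hl0.le (by linarith)]; congr 1; ring
    calc _ = Real.pi * R ^ 2 * l * l ^ (p - 1) := by rw [← e2]; ring
      _ ≤ _ := h4
      _ = A := by rw [mul_right_comm, e1, one_mul]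
  have h5 : l ^ p = u a ^ p / 2 ^ p := by rw [hl, Real.div_rpow h0.le (by norm_num)]
  rw [h5] at h3
  rw [div_mul_eq_mul_div, le_div_iff₀ hpi]
  calc R ^ 2 * u a ^ p * Real.pi = 2 ^ p * (Real.pi * R ^ 2 * (u a ^ p / 2 ^ p)) := by
        field_simp
    _ ≤ _ := by gcongr

/-- Maximise `(R - dist z a) ^ (2 / p) * u z`; the exponent makes the `p`-th power of the weight a
squared radius. Near the maximum point `z`, within half its distance `d` to the boundary, `u ≤ 2 ^
(2 / p) * u z`, so that `u` is bounded there by a multiple of `(u z) ^ (1 - p) * u ^ p`. The mean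
value inequality at `z` bounds `d ^ 2 * u z ^ p`, which by maximality dominates `R ^ 2 * u a ^ p`.
-/
theorem AreaSubmean.rpow_of_le_one {p : ℝ} (hp0 : 0 < p) (hp : p ≤ 1) {u : ℂ → ℝ} {a : ℂ} {R : ℝ}
    (hR : 0 < R) (hu : ∀ z, 0 ≤ u z) (huc : ContinuousOn u (closedBall a R))
    (h : AreaSubmean u a R) :
    ENNReal.ofReal (R ^ 2) * ENNReal.ofReal (u a ^ p) ≤
      ENNReal.ofReal (4 * (2 ^ (2 / p)) ^ (1 - p) / Real.pi) *
        ∫⁻ w in ball a R, ENNReal.ofReal (u w ^ p) := by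
  have hpi := Real.pi_pos
  have ha : a ∈ closedBall a R := mem_closedBall_self hR.le
  have h2p : 0 < 2 / p := by positivity
  obtain ⟨z, hz, hmax⟩ := (isCompact_closedBall a R).exists_isMaxOn ⟨a, ha⟩
    (f := fun z => (R - dist z a) ^ (2 / p) * u z)
    (ContinuousOn.mul (ContinuousOn.rpow_const (by fun_prop) fun _ _ => Or.inr h2p.le) huc)
  rw [isMaxOn_iff] at hmax
  rw [mem_closedBall] at hz
  have hm := hmax a ha
  simp only [dist_self, sub_zero] at hm
  rcases (hu a).eq_or_lt with h0 | h0
  · rw [← h0, Real.zero_rpow hp0.ne']; simp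
  set d := R - dist z a with hd
  have hM : 0 < d ^ (2 / p) * u z := lt_of_lt_of_le (by positivity) hm
  have huz : 0 < u z := by
    rcases (hu z).eq_or_lt with h | h
    · rw [← h, mul_zero] at hM; exact absurd hM (lt_irrefl _)
    · exact h
  have hd0 : 0 < d := by
    rcases (sub_nonneg.2 hz).eq_or_lt with h | h
    · rw [hd, ← h, Real.zero_rpow h2p.ne', zero_mul] at hM
      exact absurd hM (lt_irrefl _)
    · exact h
  have hsub : ball z (d / 2) ⊆ ball a R := ball_subset_ball' (by linarith)
  by_cases hA : ∫⁻ w in ball a R, ENNReal.ofReal (u w ^ p) = ∞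
  · rw [hA, ENNReal.mul_top]
    · exact le_top
    · simpa using (by positivity : 0 < 4 * ((2 : ℝ) ^ (2 / p)) ^ (1 - p) / Real.pi)
  set K : ℝ := 2 ^ (2 / p) with hK
  have hK0 : 0 < K := by positivity
  have hpt : ∀ w ∈ ball z (d / 2), u w ≤ (K * u z) ^ (1 - p) * u w ^ p := by
    intro w hw
    have hw1 : d / 2 ≤ R - dist w a := by
      rw [mem_ball] at hw
      linarith [dist_triangle w z a]
    have h1 := hmax w (ball_subset_closedBall (hsub hw))
    have h2 : (d / 2) ^ (2 / p) * u w ≤ d ^ (2 / p) * u z :=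
      (mul_le_mul_of_nonneg_right (Real.rpow_le_rpow (by positivity) hw1 h2p.le) (hu w)).trans h1
    have h3 : u w ≤ K * u z := by
      rw [Real.div_rpow hd0.le (by norm_num), ← hK, div_mul_eq_mul_div, div_le_iff₀ hK0] at h2
      have h4 : 0 < d ^ (2 / p) := by positivity
      nlinarith
    rcases (hu w).eq_or_lt with h5 | h5
    · rw [← h5, Real.zero_rpow hp0.ne', mul_zero]
    calc u w = u w ^ (1 - p) * u w ^ p := by rw [← Real.rpow_add h5]; simp
      _ ≤ _ := by gcongr
  have h1 : ENNReal.ofReal (Real.pi * (d / 2) ^ 2) * ENNReal.ofReal (u z) ≤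
      ENNReal.ofReal ((K * u z) ^ (1 - p)) * ∫⁻ w in ball a R, ENNReal.ofReal (u w ^ p) := by
    refine (h z (d / 2) (by positivity) hsub).trans ?_
    calc _ ≤ ∫⁻ w in ball z (d / 2),
            ENNReal.ofReal ((K * u z) ^ (1 - p)) * ENNReal.ofReal (u w ^ p) := by
          refine setLIntegral_mono' measurableSet_ball fun w hw => ?_
          rw [← ENNReal.ofReal_mul (by positivity)]
          exact ENNReal.ofReal_le_ofReal (hpt w hw)
      _ ≤ ∫⁻ w in ball a R, ENNReal.ofReal ((K * u z) ^ (1 - p)) * ENNReal.ofReal (u w ^ p) :=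
          lintegral_mono_set hsub
      _ = _ := lintegral_const_mul' _ _ ENNReal.ofReal_ne_top
  obtain ⟨A, hA'⟩ : ∃ A : ℝ≥0, (A : ℝ≥0∞) = ∫⁻ w in ball a R, ENNReal.ofReal (u w ^ p) :=
    ⟨_, ENNReal.coe_toNNReal hA⟩
  rw [← hA'] at h1 ⊢
  rw [← ENNReal.ofReal_coe_nnreal (p := A)] at h1 ⊢
  rw [← ENNReal.ofReal_mul (by positivity), ← ENNReal.ofReal_mul (by positivity),
    ENNReal.ofReal_le_ofReal_iff (by positivity)] at h1
  rw [← ENNReal.ofReal_mul (by positivity), ← ENNReal.ofReal_mul (by positivity)]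
  refine ENNReal.ofReal_le_ofReal ?_
  have hx : ∀ x : ℝ, 0 < x → (x ^ (2 / p)) ^ p = x ^ 2 := by
    intro x hx
    rw [← Real.rpow_mul hx.le, div_mul_cancel₀ _ hp0.ne']
    exact_mod_cast Real.rpow_natCast x 2
  have h2 : R ^ 2 * u a ^ p ≤ d ^ 2 * u z ^ p := by
    have := Real.rpow_le_rpow (by positivity) hm hp0.le
    rwa [Real.mul_rpow (by positivity) h0.le, Real.mul_rpow (by positivity) huz.le, hx R hR,
      hx d hd0] at this
  refine h2.trans ?_
  have e1 : u z ^ (1 - p) * u z ^ p = u z := by rw [← Real.rpow_add huz]; simp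
  rw [Real.mul_rpow hK0.le huz.le] at h1
  have e2 : 0 < u z ^ (1 - p) := by positivity
  have h3 : Real.pi * (d / 2) ^ 2 * u z ^ p ≤ K ^ (1 - p) * A := by
    refine le_of_mul_le_mul_left ?_ e2
    calc u z ^ (1 - p) * (Real.pi * (d / 2) ^ 2 * u z ^ p)
        = Real.pi * (d / 2) ^ 2 * (u z ^ (1 - p) * u z ^ p) := by ring
      _ ≤ K ^ (1 - p) * u z ^ (1 - p) * A := by rw [e1]; exact h1
      _ = _ := by ring
  rw [div_mul_eq_mul_div, le_div_iff₀ hpi]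
  linarith

theorem exists_areaSubmean_rpow {p : ℝ} (hp : 0 < p) :
    ∃ K : ℝ≥0, ∀ (u : ℂ → ℝ) (a : ℂ) (R : ℝ), 0 < R → (∀ z, 0 ≤ u z) →
      ContinuousOn u (closedBall a R) → AreaSubmean u a R →
      ENNReal.ofReal (R ^ 2) * ENNReal.ofReal (u a ^ p) ≤
        K * ∫⁻ w in ball a R, ENNReal.ofReal (u w ^ p) := by
  rcases le_total 1 p with h1 | h1
  · exact ⟨_, fun u a R hR hu _ h => h.rpow_of_one_le h1 hR hu⟩
  · exact ⟨_, fun u a R hR hu huc h => h.rpow_of_le_one hp h1 hR hu huc⟩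

/-! ### Quaternion valued holomorphic functions -/

/-- The left complex linear coordinate functional `q ↦ Re q - i Re (I q)` of the slice `ℂ_I`. -/
noncomputable def sliceCoord (I : ℍ[ℝ]) : ℍ[ℝ] →ₗ[ℝ] ℂ where
  toFun q := ⟨q.re, -(I * q).re⟩
  map_add' q r := by
    apply Complex.ext
    · simp
    · simp only [mul_add, Quaternion.re_add, Complex.add_im]; ring
  map_smul' c q := by
    apply Complex.ext
    · simp
    · simp only [mul_smul_comm, Quaternion.re_smul, smul_eq_mul, RingHom.id_apply,
        Complex.real_smul, Complex.mul_im, Complex.ofReal_re, Complex.ofReal_im]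
      ring

theorem sliceCoord_apply (I q : ℍ[ℝ]) : sliceCoord I q = ⟨q.re, -(I * q).re⟩ := rfl

theorem sliceCoord_mul_left {I : ℍ[ℝ]} (hI : I ∈ imagUnits) (q : ℍ[ℝ]) :
    sliceCoord I (I * q) = Complex.I * sliceCoord I q := by
  simp only [sliceCoord_apply, ← mul_assoc, imagUnits_mul_self hI]
  apply Complex.ext <;> simp

/-- By duality: `Re (w * sliceCoord I q)` is the real part of `slicePt I w * q`, tested at `w = conj
(sliceCoord I q)`. -/
theorem norm_sliceCoord_le {I : ℍ[ℝ]} (hI : I ∈ imagUnits) (q : ℍ[ℝ]) :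
    ‖sliceCoord I q‖ ≤ ‖q‖ := by
  have h1 : ∀ w : ℂ, (slicePt I w * q).re = (w * sliceCoord I q).re := by
    intro w
    have : slicePt I w * q = w.re • q + w.im • (I * q) := by
      rw [slicePt, add_mul, Quaternion.coe_mul_eq_smul, ← Quaternion.coe_commutes, mul_assoc,
        Quaternion.coe_mul_eq_smul]
    rw [this, sliceCoord_apply]
    simp only [Quaternion.re_add, Quaternion.re_smul, smul_eq_mul, Complex.mul_re]
    ring
  have h2 : ‖sliceCoord I q‖ ^ 2 ≤ ‖sliceCoord I q‖ * ‖q‖ := by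
    calc ‖sliceCoord I q‖ ^ 2 = (conj (sliceCoord I q) * sliceCoord I q).re := by
          rw [Complex.conj_mul']; norm_cast
      _ = (slicePt I (conj (sliceCoord I q)) * q).re := (h1 _).symm
      _ ≤ ‖slicePt I (conj (sliceCoord I q)) * q‖ := by
          set x := slicePt I (conj (sliceCoord I q)) * q
          have := real_inner_le_norm x (1 : ℍ[ℝ])
          rwa [Quaternion.inner_def, star_one, mul_one, norm_one, mul_one] at this
      _ = _ := by rw [norm_mul, norm_slicePt hI, RCLike.norm_conj]
  by_contra! hlt
  nlinarith [norm_nonneg q, norm_nonneg (sliceCoord I q)]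

/-- Right multiplication commutes with the left complex structure, so `sliceCoord I (g z * c)` is
holomorphic for every constant `c`. The choice `c = star q` makes this functional recover the norm
of `q`. -/
theorem sliceCoord_mul_star {I : ℍ[ℝ]} (hI : I ∈ imagUnits) (q : ℍ[ℝ]) :
    sliceCoord I (q * star q) = ((‖q‖ * ‖q‖ : ℝ) : ℂ) := by
  rw [Quaternion.self_mul_star, Quaternion.normSq_eq_norm_mul_self, sliceCoord_apply]
  apply Complex.ext
  · simp
  · rw [← Quaternion.coe_commutes, Quaternion.coe_mul_eq_smul]
    simp [hI.1]

/-- Holomorphy at `z` of a quaternion valued function, for the complex structure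
given by left multiplication by `I`. -/
def LeftHolomorphicAt (I : ℍ[ℝ]) (g : ℂ → ℍ[ℝ]) (z : ℂ) : Prop :=
  ∃ L : ℂ →L[ℝ] ℍ[ℝ], HasFDerivAt g L z ∧ L Complex.I = I * L 1

namespace LeftHolomorphicAt

variable {I J : ℍ[ℝ]} {g h : ℂ → ℍ[ℝ]} {z : ℂ}

theorem continuousAt (hg : LeftHolomorphicAt I g z) : ContinuousAt g z :=
  let ⟨_, h, _⟩ := hg
  h.continuousAt

theorem add (hg : LeftHolomorphicAt I g z) (hh : LeftHolomorphicAt I h z) :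
    LeftHolomorphicAt I (fun z => g z + h z) z := by
  obtain ⟨L, hL, e⟩ := hg
  obtain ⟨M, hM, e'⟩ := hh
  exact ⟨L + M, hL.add hM, by simp [e, e', mul_add]⟩

theorem sub (hg : LeftHolomorphicAt I g z) (hh : LeftHolomorphicAt I h z) :
    LeftHolomorphicAt I (fun z => g z - h z) z := by
  obtain ⟨L, hL, e⟩ := hg
  obtain ⟨M, hM, e'⟩ := hh
  exact ⟨L - M, hL.sub hM, by simp [e, e', mul_sub]⟩

/-- A left factor that intertwines `I` and `J` carries one complex structure to the other. -/
theorem const_mul {A : ℍ[ℝ]} (hA : A * I = J * A) (hg : LeftHolomorphicAt I g z) :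
    LeftHolomorphicAt J (fun z => A * g z) z := by
  obtain ⟨L, hL, e⟩ := hg
  refine ⟨A • L, hL.const_smul A, ?_⟩
  simp only [smul_apply, smul_eq_mul, e]
  rw [← mul_assoc, hA, mul_assoc]

theorem comp_conj (hg : LeftHolomorphicAt I g (conj z)) :
    LeftHolomorphicAt (-I) (fun z => g (conj z)) z := by
  obtain ⟨L, hL, e⟩ := hg
  refine ⟨L.comp (Complex.conjCLE : ℂ →L[ℝ] ℂ), hL.comp z Complex.conjCLE.hasFDerivAt, ?_⟩
  simp [e]

theorem differentiableAt_sliceCoord (hI : I ∈ imagUnits) (hg : LeftHolomorphicAt I g z)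
    (c : ℍ[ℝ]) : DifferentiableAt ℂ (fun z => sliceCoord I (g z * c)) z := by
  obtain ⟨L, hL, e⟩ := hg
  have h1 := (sliceCoord I).toContinuousLinearMap.hasFDerivAt.comp z (hL.mul_const' c)
  have h2 := differentiableAt_complex_iff_differentiableAt_real
    (f := fun z => sliceCoord I (g z * c)) (x := z)
  refine h2.2 ⟨h1.differentiableAt, ?_⟩
  have h3 : fderiv ℝ (fun z => sliceCoord I (g z * c)) z = _ := h1.fderiv
  rw [h3]
  simp [e, mul_assoc, sliceCoord_mul_left hI]

end LeftHolomorphicAt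

/-- Identity theorem on the real diameter. -/
theorem eqOn_zero_of_leftHolomorphic {J : ℍ[ℝ]} (hJ : J ∈ imagUnits) {g : ℂ → ℍ[ℝ]}
    (hg : ∀ z ∈ ball (0 : ℂ) 1, LeftHolomorphicAt J g z)
    (h0 : ∀ x : ℝ, g x = 0) : ∀ z ∈ ball (0 : ℂ) 1, g z = 0 := by
  have key : ∀ c : ℍ[ℝ], ∀ z ∈ ball (0 : ℂ) 1, sliceCoord J (g z * c) = 0 := by
    intro c
    have hd : DifferentiableOn ℂ (fun z => sliceCoord J (g z * c)) (ball 0 1) := fun z hz =>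
      ((hg z hz).differentiableAt_sliceCoord hJ c).differentiableWithinAt
    refine AnalyticOnNhd.eqOn_of_preconnected_of_frequently_eq (z₀ := 0)
      (hd.analyticOnNhd isOpen_ball) analyticOnNhd_const (convex_ball _ _).isPreconnected
      (mem_ball_self one_pos) ?_
    have ht : Filter.Tendsto (fun x : ℝ => (x : ℂ)) (nhdsWithin 0 {0}ᶜ)
        (nhdsWithin 0 {0}ᶜ) := by
      refine tendsto_nhdsWithin_iff.2 ⟨?_, ?_⟩
      · exact (Complex.continuous_ofReal.tendsto' 0 0 (by simp)).mono_left nhdsWithin_le_nhds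
      · filter_upwards [self_mem_nhdsWithin] with x hx
        simpa using hx
    refine ht.frequently (Filter.Eventually.frequently (.of_forall fun x => ?_))
    simp [h0 x]
  intro z hz
  have := key (star (g z)) z hz
  rw [sliceCoord_mul_star hJ] at this
  simpa using this

/-- The scalar function `sliceCoord I (g w * star (g z))` equals `‖g z‖ ^ 2` at `w = z` and is at
most `‖g w‖ * ‖g z‖` elsewhere; one factor `‖g z‖` cancels. -/
theorem areaSubmean_of_leftHolomorphic {I : ℍ[ℝ]} (hI : I ∈ imagUnits) {g : ℂ → ℍ[ℝ]} {a : ℂ}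
    {R : ℝ} (hg : ∀ z ∈ ball a R, LeftHolomorphicAt I g z) :
    AreaSubmean (fun z => ‖g z‖) a R := by
  intro z ρ hρ hsub
  by_cases h0 : ‖g z‖ = 0
  · simp [h0]
  have h0' : 0 < ‖g z‖ := (norm_nonneg _).lt_of_ne' h0
  have h1 := enorm_le_lintegral_ball (F := fun w => sliceCoord I (g w * star (g z))) hρ
    fun w hw => ((hg w (hsub hw)).differentiableAt_sliceCoord hI _).differentiableWithinAt
  simp only [sliceCoord_mul_star hI, ← ofReal_norm, Complex.norm_real] at h1
  rw [Real.norm_of_nonneg (by positivity), ENNReal.ofReal_mul h0'.le, ← mul_assoc] at h1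
  have h2 : ∫⁻ w in ball z ρ, ENNReal.ofReal ‖sliceCoord I (g w * star (g z))‖ ≤
      (∫⁻ w in ball z ρ, ENNReal.ofReal ‖g w‖) * ENNReal.ofReal ‖g z‖ := by
    rw [← lintegral_mul_const' _ _ ENNReal.ofReal_ne_top]
    refine lintegral_mono fun w => ?_
    rw [← ENNReal.ofReal_mul (norm_nonneg _)]
    refine ENNReal.ofReal_le_ofReal ((norm_sliceCoord_le hI _).trans ?_)
    rw [norm_mul, Quaternion.norm_star]
  exact (ENNReal.mul_le_mul_iff_left (by simpa using h0') ENNReal.ofReal_ne_top).1 (h1.trans h2)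

/-! ### Slice regular functions and the representation formula -/

theorem hasDerivAt_mk_re (x y : ℝ) : HasDerivAt (fun t : ℝ => (⟨t, y⟩ : ℂ)) 1 x := by
  have h : (fun t : ℝ => (⟨t, y⟩ : ℂ)) = fun t : ℝ => (t : ℂ) + y * Complex.I := by
    ext t; exact Complex.mk_eq_add_mul_I t y
  rw [h]
  exact (Complex.ofRealCLM.hasDerivAt (x := x)).add_const _

theorem hasDerivAt_mk_im (x y : ℝ) : HasDerivAt (fun t : ℝ => (⟨x, t⟩ : ℂ)) Complex.I y := by
  have h : (fun t : ℝ => (⟨x, t⟩ : ℂ)) = fun t : ℝ => (x : ℂ) + t * Complex.I := by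
    ext t; exact Complex.mk_eq_add_mul_I x t
  rw [h]
  simpa using ((Complex.ofRealCLM.hasDerivAt (x := y)).mul_const Complex.I).const_add (x : ℂ)

theorem dbar_eq_of_hasFDerivAt {I : ℍ[ℝ]} {f : ℍ[ℝ] → ℍ[ℝ]} {x y : ℝ} {L : ℂ →L[ℝ] ℍ[ℝ]}
    (h : HasFDerivAt (fun z => f (slicePt I z)) L ⟨x, y⟩) :
    dbar I f x y = (1 / 2 : ℝ) • (L 1 + I * L Complex.I) := by
  have h1 := (h.comp_hasDerivAt x (hasDerivAt_mk_re x y)).deriv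
  have h2 := (h.comp_hasDerivAt y (hasDerivAt_mk_im x y)).deriv
  simp only [Function.comp_def] at h1 h2
  rw [dbar, h1, h2]

theorem SliceRegularOn.leftHolomorphicAt {f : ℍ[ℝ] → ℍ[ℝ]} (hf : SliceRegularOn f unitBall)
    {I : ℍ[ℝ]} (hI : I ∈ imagUnits) {z : ℂ} (hz : z ∈ ball (0 : ℂ) 1) :
    LeftHolomorphicAt I (fun z => f (slicePt I z)) z := by
  rw [mem_ball_zero_iff] at hz
  have hm := (slicePt_mem_unitBall hI z).2 hz
  have h1 := ((hf.1 _ hm).differentiableAt (isOpen_unitBall.mem_nhds hm)).hasFDerivAt.comp z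
    (hasFDerivAt_slicePt hI z)
  refine ⟨_, h1, ?_⟩
  have h2 := hf.2 I hI z.re z.im hm
  rw [dbar_eq_of_hasFDerivAt (x := z.re) (y := z.im) h1, smul_eq_zero_iff_right (by norm_num),
    add_eq_zero_iff_eq_neg] at h2
  rw [h2, mul_neg, ← mul_assoc, imagUnits_mul_self hI]
  simp

/-- The estimate that follows from the representation formula. -/
theorem SliceRegularOn.norm_slicePt_le {f : ℍ[ℝ] → ℍ[ℝ]} (hf : SliceRegularOn f unitBall)
    {I J : ℍ[ℝ]} (hI : I ∈ imagUnits) (hJ : J ∈ imagUnits) {z : ℂ} (hz : z ∈ ball (0 : ℂ) 1) :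
    ‖f (slicePt J z)‖ ≤ ‖f (slicePt I z)‖ + ‖f (slicePt I (conj z))‖ := by
  have hII := imagUnits_mul_self hI
  have hJJ := imagUnits_mul_self hJ
  -- Coefficients of the representation formula `f(x + Jy) = A f(x + Iy) + B f(x - Iy)`. Both sides
  -- are holomorphic for `J` and agree on the real diameter since `A + B = 1`.
  set A : ℍ[ℝ] := (2⁻¹ : ℝ) • (1 - J * I) with hA
  set B : ℍ[ℝ] := (2⁻¹ : ℝ) • (1 + J * I) with hB
  have hAI : A * I = J * A := by
    rw [hA, smul_mul_assoc, mul_smul_comm, sub_mul, mul_sub, mul_assoc, hII, ← mul_assoc, hJJ]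
    congr 1
    noncomm_ring
  have hBI : B * (-I) = J * B := by
    rw [hB, smul_mul_assoc, mul_smul_comm, add_mul, mul_add, mul_neg, mul_neg, mul_assoc, hII,
      ← mul_assoc, hJJ]
    congr 1
    noncomm_ring
  have hnorm : ‖J * I‖ = 1 := by rw [norm_mul, hI.2, hJ.2, one_mul]
  have hA1 : ‖A‖ ≤ 1 := by
    rw [hA, norm_smul]
    have := norm_sub_le (1 : ℍ[ℝ]) (J * I)
    rw [norm_one, hnorm] at this
    norm_num
    linarith
  have hB1 : ‖B‖ ≤ 1 := by
    rw [hB, norm_smul]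
    have := norm_add_le (1 : ℍ[ℝ]) (J * I)
    rw [norm_one, hnorm] at this
    norm_num
    linarith
  have hAB : A + B = 1 := by
    rw [hA, hB, ← smul_add, show (1 - J * I) + (1 + J * I) = (2 : ℝ) • (1 : ℍ[ℝ]) by
      rw [two_smul]; abel, smul_smul]
    norm_num
  have hconj : ∀ w ∈ ball (0 : ℂ) 1, conj w ∈ ball (0 : ℂ) 1 := by
    intro w hw
    simpa using hw
  have key := eqOn_zero_of_leftHolomorphic hJ
    (g := fun w => f (slicePt J w) - (A * f (slicePt I w) + B * f (slicePt I (conj w))))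
    (fun w hw => (hf.leftHolomorphicAt hJ hw).sub
      (((hf.leftHolomorphicAt hI hw).const_mul hAI).add
        ((LeftHolomorphicAt.comp_conj (hf.leftHolomorphicAt hI (hconj w hw))).const_mul hBI)))
    (fun x => by
      have h : ∀ K : ℍ[ℝ], slicePt K (x : ℂ) = (x : ℍ[ℝ]) := fun K => by simp [slicePt]
      simp only [Complex.conj_ofReal, h]
      rw [← add_mul, hAB, one_mul, sub_self]) z hz
  rw [sub_eq_zero.1 key]
  refine (norm_add_le _ _).trans (add_le_add ?_ ?_) <;> rw [norm_mul]
  · exact mul_le_of_le_one_left (norm_nonneg _) hA1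
  · exact mul_le_of_le_one_left (norm_nonneg _) hB1

theorem norm_eq_of_eq_slicePt {q : ℍ[ℝ]} {z : ℂ} (h : ∃ J ∈ imagUnits, q = slicePt J z) :
    ‖z‖ = ‖q‖ := by
  obtain ⟨J, hJ, rfl⟩ := h
  exact (norm_slicePt hJ z).symm

/-! ### From the tube bound to the Carleson inequality -/

section Carleson

variable [MeasurableSpace ℍ[ℝ]] [BorelSpace ℍ[ℝ]]

theorem bergmanNorm_rpow {p : ℝ} (hp : 0 < p) (f : ℍ[ℝ] → ℍ[ℝ]) :
    bergmanNorm p f ^ p =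
      ⨆ I ∈ imagUnits, ∫⁻ z in ball (0 : ℂ) 1, ‖f (slicePt I z)‖ₑ ^ p := by
  rw [bergmanNorm, ← ENNReal.rpow_mul, one_div_mul_cancel hp.ne', ENNReal.rpow_one]
  exact iSup_congr fun I => iSup_congr fun hI => setLIntegral_sliceBall hI _

/-- The submean inequality writes `G (ζ q)` below an average of `G` with kernel `k q w`. After
Tonelli, `k · w` is supported in the tube about `w` and is at most `4 / (r (1 - ‖w‖)) ^ 2` there;
the tube bound and the area estimate cancel the dependence on `w`. -/
theorem lintegral_comp_le_of_tubeBound {μ : Measure ℍ[ℝ]} [IsFiniteMeasure μ] {r : ℝ}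
    (hr : r ∈ Set.Ioo (0 : ℝ) 1) {I : ℍ[ℝ]} (hI : I ∈ imagUnits) {C K : ℝ≥0}
    (hC : ∀ α ∈ sliceBall I, μ (tube I α r) ≤ C * sliceArea I (discSlice I α r))
    {G : ℂ → ℝ≥0∞} (hG : Measurable G)
    (hK : ∀ z ∈ ball (0 : ℂ) 1, ENNReal.ofReal ((r * (1 - ‖z‖)) ^ 2) * G z ≤
      K * ∫⁻ w in ball z (r * (1 - ‖z‖)), G w)
    {ζ : ℍ[ℝ] → ℂ} (hζm : Measurable ζ) (hζ : ∀ q, ∃ J ∈ imagUnits, q = slicePt J (ζ q)) :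
    ∫⁻ q in unitBall, G (ζ q) ∂μ ≤
      K * (C * (ENNReal.ofReal (16 / (1 - r) ^ 2) * NNReal.pi)) * ∫⁻ w in ball (0 : ℂ) 1, G w := by
  have hr0 := hr.1
  have hr1 : 0 < 1 - r := by linarith [hr.2]
  -- Written as an indicator on the product space, which makes joint measurability immediate.
  set k : ℍ[ℝ] → ℂ → ℝ≥0∞ := fun q w =>
    {x : ℍ[ℝ] × ℂ | ‖x.2 - ζ x.1‖ < r * (1 - ‖ζ x.1‖)}.indicator
      (fun x => ENNReal.ofReal (1 / (r * (1 - ‖ζ x.1‖)) ^ 2)) (q, w) with hk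
  have hkm : Measurable (Function.uncurry k) := by
    refine Measurable.indicator (by fun_prop) (measurableSet_lt (by fun_prop) (by fun_prop))
  have hkmem : ∀ q w, ‖w - ζ q‖ < r * (1 - ‖ζ q‖) →
      k q w = ENNReal.ofReal (1 / (r * (1 - ‖ζ q‖)) ^ 2) := fun q w h =>
    Set.indicator_of_mem (s := {x : ℍ[ℝ] × ℂ | ‖x.2 - ζ x.1‖ < r * (1 - ‖ζ x.1‖)})
      (a := (q, w)) h _
  have hknot : ∀ q w, ¬‖w - ζ q‖ < r * (1 - ‖ζ q‖) → k q w = 0 := fun q w h =>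
    Set.indicator_of_notMem (s := {x : ℍ[ℝ] × ℂ | ‖x.2 - ζ x.1‖ < r * (1 - ‖ζ x.1‖)})
      (a := (q, w)) h _
  have h1 : ∀ q ∈ unitBall, G (ζ q) ≤ K * ∫⁻ w in ball (0 : ℂ) 1, k q w * G w := by
    intro q hq
    have hz : ‖ζ q‖ < 1 := by rw [norm_eq_of_eq_slicePt (hζ q)]; exact hq
    set ρ := r * (1 - ‖ζ q‖) with hρ
    have hρ0 : 0 < ρ := mul_pos hr0 (by linarith)
    have hsub : ball (ζ q) ρ ⊆ ball 0 1 := by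
      refine ball_subset_ball' ?_
      rw [dist_zero_right]
      nlinarith [hr.2]
    calc G (ζ q) = ENNReal.ofReal (1 / ρ ^ 2) * (ENNReal.ofReal (ρ ^ 2) * G (ζ q)) := by
          rw [← mul_assoc, ← ENNReal.ofReal_mul (by positivity),
            one_div_mul_cancel (by positivity), ENNReal.ofReal_one, one_mul]
      _ ≤ ENNReal.ofReal (1 / ρ ^ 2) * (K * ∫⁻ w in ball (ζ q) ρ, G w) := by
          exact mul_le_mul_right (hK _ (by simpa using hz)) _
      _ = K * ∫⁻ w in ball (ζ q) ρ, ENNReal.ofReal (1 / ρ ^ 2) * G w := by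
          rw [lintegral_const_mul _ hG, mul_left_comm]
      _ = K * ∫⁻ w in ball (ζ q) ρ, k q w * G w := by
          congr 1
          refine setLIntegral_congr_fun measurableSet_ball fun w hw => ?_
          rw [hkmem q w (by simpa [dist_eq_norm] using hw)]
      _ ≤ _ := by gcongr
  have h2 : ∀ w ∈ ball (0 : ℂ) 1, ∫⁻ q in unitBall, k q w ∂μ ≤
      C * (ENNReal.ofReal (16 / (1 - r) ^ 2) * NNReal.pi) := by
    intro w hw
    rw [mem_ball_zero_iff] at hw
    have hw0 : 0 < 1 - ‖w‖ := by linarith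
    have hpt : ∀ q ∈ unitBall, k q w ≤ (tube I (slicePt I w) r).indicator
        (fun _ => ENNReal.ofReal (4 / (r * (1 - ‖w‖)) ^ 2)) q := by
      intro q hq
      have hz : ‖ζ q‖ < 1 := by rw [norm_eq_of_eq_slicePt (hζ q)]; exact hq
      by_cases hqw : ‖w - ζ q‖ < r * (1 - ‖ζ q‖)
      · obtain ⟨J, hJ, hqJ⟩ := hζ q
        have hmem : q ∈ tube I (slicePt I w) r := by
          rw [hqJ]
          refine slicePt_mem_tube hI hJ hz hw ?_
          -- The roles of centre and point are exchanged: `w` is near `ζ q`, and the tube is centred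
          -- at `w`.
          have h := one_sub_norm_le_norm_one_sub_mul (a := ζ q) (z := conj w)
            (by rw [RCLike.norm_conj]; exact hw.le)
          rw [norm_sub_rev, mul_comm (ζ q)]
          exact hqw.trans_le (mul_le_mul_of_nonneg_left h hr0.le)
        rw [Set.indicator_of_mem hmem, hkmem q w hqw]
        refine ENNReal.ofReal_le_ofReal ?_
        have h3 : 1 - ‖w‖ ≤ 2 * (1 - ‖ζ q‖) := by
          have := norm_sub_norm_le (ζ q) w
          rw [norm_sub_rev] at this
          nlinarith [hr.2]
        have h4 : (r * (1 - ‖w‖)) ^ 2 ≤ (r * (2 * (1 - ‖ζ q‖))) ^ 2 := by gcongr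
        have h5 : 0 < 1 - ‖ζ q‖ := by linarith
        rw [div_le_div_iff₀ (by positivity) (by positivity)]
        linarith
      · rw [hknot q w hqw]
        exact zero_le
    calc ∫⁻ q in unitBall, k q w ∂μ
        ≤ ∫⁻ q in unitBall, (tube I (slicePt I w) r).indicator
            (fun _ => ENNReal.ofReal (4 / (r * (1 - ‖w‖)) ^ 2)) q ∂μ :=
          setLIntegral_mono' isOpen_unitBall.measurableSet hpt
      _ ≤ ∫⁻ q, (tube I (slicePt I w) r).indicator
            (fun _ => ENNReal.ofReal (4 / (r * (1 - ‖w‖)) ^ 2)) q ∂μ :=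
          setLIntegral_le_lintegral _ _
      _ ≤ ENNReal.ofReal (4 / (r * (1 - ‖w‖)) ^ 2) * μ (tube I (slicePt I w) r) :=
          lintegral_indicator_const_le _ _
      _ ≤ ENNReal.ofReal (4 / (r * (1 - ‖w‖)) ^ 2) *
            (C * (ENNReal.ofReal (2 * r / (1 - r) * (1 - ‖w‖)) ^ 2 * NNReal.pi)) := by
          gcongr
          exact (hC _ ((slicePt_mem_sliceBall hI w).2 hw)).trans
            (by gcongr; exact sliceArea_discSlice_le hI hw hr)
      _ = _ := by
          rw [mul_left_comm, ← mul_assoc (ENNReal.ofReal (4 / (r * (1 - ‖w‖)) ^ 2)),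
            ← ENNReal.ofReal_pow (by positivity), ← ENNReal.ofReal_mul (by positivity)]
          congr 3
          field_simp
          norm_num
  calc ∫⁻ q in unitBall, G (ζ q) ∂μ
      ≤ ∫⁻ q in unitBall, (K * ∫⁻ w in ball (0 : ℂ) 1, k q w * G w) ∂μ :=
        setLIntegral_mono' isOpen_unitBall.measurableSet h1
    _ = K * ∫⁻ q in unitBall, (∫⁻ w in ball (0 : ℂ) 1, k q w * G w) ∂μ :=
        lintegral_const_mul' _ _ ENNReal.coe_ne_top
    _ = K * ∫⁻ w in ball (0 : ℂ) 1, ∫⁻ q in unitBall, k q w * G w ∂μ := by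
        rw [lintegral_lintegral_swap]
        exact (hkm.mul (hG.comp measurable_snd)).aemeasurable
    _ = K * ∫⁻ w in ball (0 : ℂ) 1, (∫⁻ q in unitBall, k q w ∂μ) * G w := by
        congr 1
        refine lintegral_congr fun w => lintegral_mul_const _ ?_
        exact hkm.comp (measurable_id.prodMk measurable_const)
    _ ≤ K * ∫⁻ w in ball (0 : ℂ) 1,
          (C * (ENNReal.ofReal (16 / (1 - r) ^ 2) * NNReal.pi)) * G w := by
        refine mul_le_mul_right (setLIntegral_mono' measurableSet_ball fun w hw => ?_) _
        exact mul_le_mul_left (h2 w hw) _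
    _ = _ := by rw [lintegral_const_mul _ hG, ← mul_assoc]

/-- Only the discs of one slice enter. The preceding lemma is used twice, for a representative of
`q` in the closed upper half plane and for its conjugate. -/
theorem isCarleson_of_tubeBound {p : ℝ} (hp : 0 < p) {μ : Measure ℍ[ℝ]} [IsFiniteMeasure μ]
    {r : ℝ} (hr : r ∈ Set.Ioo (0 : ℝ) 1) (h : TubeBound μ r) : IsCarleson p μ := by
  obtain ⟨C, hC⟩ := h
  obtain ⟨K, hK⟩ := exists_areaSubmean_rpow hp
  obtain ⟨I, hI, -⟩ := exists_slicePt 0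
  set K' : ℝ≥0 := K * (C * (Real.toNNReal (16 / (1 - r) ^ 2) * NNReal.pi)) with hK'
  refine ⟨Real.toNNReal (2 ^ p) * (2 * K'), fun f hf => ?_⟩
  -- Off the ball `f` is arbitrary; cutting off there makes `G` measurable.
  set G : ℂ → ℝ≥0∞ := (ball (0 : ℂ) 1).indicator fun z => ‖f (slicePt I z)‖ₑ ^ p with hG
  have hcont : ContinuousOn (fun z => f (slicePt I z)) (ball 0 1) := fun z hz =>
    (hf.1.leftHolomorphicAt hI hz).continuousAt.continuousWithinAt
  have hGm : Measurable G := measurable_indicator_of_continuousOn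
    (ENNReal.continuous_rpow_const.comp_continuousOn hcont.enorm) measurableSet_ball
  have hofReal : ∀ z, ENNReal.ofReal (‖f (slicePt I z)‖ ^ p) = ‖f (slicePt I z)‖ₑ ^ p := by
    intro z
    rw [← ENNReal.ofReal_rpow_of_nonneg (norm_nonneg _) hp.le, ofReal_norm]
  have hsub : ∀ z ∈ ball (0 : ℂ) 1, ENNReal.ofReal ((r * (1 - ‖z‖)) ^ 2) * G z ≤
      K * ∫⁻ w in ball z (r * (1 - ‖z‖)), G w := by
    intro z hz
    have hz' := hz
    rw [mem_ball_zero_iff] at hz'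
    have hρ : 0 < r * (1 - ‖z‖) := mul_pos hr.1 (by linarith)
    have hcb : closedBall z (r * (1 - ‖z‖)) ⊆ ball 0 1 := by
      refine closedBall_subset_ball' ?_
      rw [dist_zero_right]
      nlinarith [hr.2]
    have h1 := hK (fun z => ‖f (slicePt I z)‖) z (r * (1 - ‖z‖)) hρ (fun _ => norm_nonneg _)
      (hcont.norm.mono hcb) (areaSubmean_of_leftHolomorphic hI fun w hw =>
        hf.1.leftHolomorphicAt hI (hcb (ball_subset_closedBall hw)))
    simp only [hofReal] at h1
    rw [hG, Set.indicator_of_mem hz]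
    refine h1.trans_eq ?_
    congr 1
    refine setLIntegral_congr_fun measurableSet_ball fun w hw => ?_
    rw [Set.indicator_of_mem (hcb (ball_subset_closedBall hw))]
  set ζ : ℍ[ℝ] → ℂ := fun q => ⟨q.re, ‖q.im‖⟩ with hζ
  have hζm : Measurable ζ := by
    have : ζ = fun q => (q.re : ℂ) + (‖q.im‖ : ℂ) * Complex.I := by
      ext q; exact Complex.mk_eq_add_mul_I _ _
    rw [this]
    have h1 := Quaternion.continuous_re.measurable
    have h2 := Quaternion.continuous_im.norm.measurable
    fun_prop
  have h1 := lintegral_comp_le_of_tubeBound hr hI (hC I hI) hGm hsub hζm exists_slicePt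
  have h2 := lintegral_comp_le_of_tubeBound hr hI (hC I hI) hGm hsub
    (Complex.continuous_conj.measurable.comp hζm) exists_slicePt_conj
  have hint : ∫⁻ w in ball (0 : ℂ) 1, G w ≤ bergmanNorm p f ^ p := by
    rw [bergmanNorm_rpow hp]
    refine le_trans (le_of_eq ?_) (le_iSup₂ I hI)
    exact setLIntegral_congr_fun measurableSet_ball fun w hw => by
      simp only [hG]
      rw [Set.indicator_of_mem hw]
  have hpt : ∀ q ∈ unitBall, ‖f q‖ₑ ^ p ≤
      ENNReal.ofReal (2 ^ p) * (G (ζ q) + G (conj (ζ q))) := by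
    intro q hq
    obtain ⟨J, hJ, hqJ⟩ := exists_slicePt q
    have hz : ζ q ∈ ball (0 : ℂ) 1 := by
      rw [mem_ball_zero_iff, norm_eq_of_eq_slicePt (exists_slicePt q)]; exact hq
    have hz' : conj (ζ q) ∈ ball (0 : ℂ) 1 := by simpa using hz
    rw [hG, Set.indicator_of_mem hz, Set.indicator_of_mem hz']
    have h3 := hf.1.norm_slicePt_le hI hJ hz
    change q = slicePt J (ζ q) at hqJ
    rw [← hqJ] at h3
    set x := ‖f (slicePt I (ζ q))‖ with hx
    set y := ‖f (slicePt I (conj (ζ q)))‖ with hy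
    have hx0 : 0 ≤ x := norm_nonneg _
    have hy0 : 0 ≤ y := norm_nonneg _
    rw [← hofReal, ← hofReal, ← ofReal_norm, ENNReal.ofReal_rpow_of_nonneg (norm_nonneg _) hp.le,
      ← ENNReal.ofReal_add (by positivity) (by positivity), ← ENNReal.ofReal_mul (by positivity)]
    refine ENNReal.ofReal_le_ofReal ?_
    -- Passing through the maximum gives `(x + y) ^ p ≤ 2 ^ p (x ^ p + y ^ p)` for every `p > 0`.
    calc ‖f q‖ ^ p ≤ (2 * max x y) ^ p := by
          refine Real.rpow_le_rpow (norm_nonneg _) (h3.trans ?_) hp.le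
          linarith [le_max_left x y, le_max_right x y]
      _ = 2 ^ p * max x y ^ p := Real.mul_rpow (by norm_num) (by positivity)
      _ ≤ 2 ^ p * (x ^ p + y ^ p) := by
          have := Real.rpow_nonneg hx0 p
          have := Real.rpow_nonneg hy0 p
          gcongr
          rcases max_choice x y with h | h <;> rw [h] <;> linarith
  have hK'' : (K' : ℝ≥0∞) = K * (C * (ENNReal.ofReal (16 / (1 - r) ^ 2) * NNReal.pi)) := by
    rw [hK']; push_cast; rfl
  rw [← hK''] at h1 h2
  calc ∫⁻ q in unitBall, ‖f q‖ₑ ^ p ∂μ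
      ≤ ∫⁻ q in unitBall, ENNReal.ofReal (2 ^ p) * (G (ζ q) + G (conj (ζ q))) ∂μ :=
        setLIntegral_mono' isOpen_unitBall.measurableSet hpt
    _ = ENNReal.ofReal (2 ^ p) * (∫⁻ q in unitBall, G (ζ q) ∂μ +
          ∫⁻ q in unitBall, G (conj (ζ q)) ∂μ) := by
        rw [lintegral_const_mul' _ _ ENNReal.ofReal_ne_top]
        exact congrArg _ (lintegral_add_left (hGm.comp hζm) _)
    _ ≤ ENNReal.ofReal (2 ^ p) * (K' * bergmanNorm p f ^ p + K' * bergmanNorm p f ^ p) := by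
        gcongr
        · exact h1.trans (by gcongr)
        · exact h2.trans (by gcongr)
    _ = _ := by
        push_cast
        rw [← two_mul, ← mul_assoc, ← mul_assoc, mul_assoc (ENNReal.ofReal (2 ^ p))]
        rfl

end Carleson

/-! ### Symmetrised kernels as test functions -/

/-- The slice regular function with real coefficients that restricts to
`((1 - z a) (1 - z (conj a)))⁻ᴺ` on every slice. -/
noncomputable def symmKernel (a : ℂ) (N : ℕ) (q : ℍ[ℝ]) : ℍ[ℝ] :=
  ((1 - (2 * a.re) • q + (‖a‖ ^ 2) • (q * q))⁻¹) ^ N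

theorem one_sub_mul_one_sub_conj (a z : ℂ) :
    (1 - z * a) * (1 - z * conj a) = 1 - (2 * a.re) • z + (‖a‖ ^ 2) • (z * z) := by
  have h1 : a + conj a = ((2 * a.re : ℝ) : ℂ) := by rw [Complex.add_conj]
  have h2 : a * conj a = ((‖a‖ ^ 2 : ℝ) : ℂ) := by rw [Complex.mul_conj']; push_cast; rfl
  rw [Complex.real_smul, Complex.real_smul, ← h1, ← h2]
  ring

theorem slicePt_symm {J : ℍ[ℝ]} (hJ : J ∈ imagUnits) (a z : ℂ) :
    1 - (2 * a.re) • slicePt J z + (‖a‖ ^ 2) • (slicePt J z * slicePt J z) =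
      slicePt J ((1 - z * a) * (1 - z * conj a)) := by
  rw [one_sub_mul_one_sub_conj]
  simp only [← sliceHom_apply hJ, map_add, map_sub, map_mul, map_smul, map_one]

theorem symmKernel_slicePt {J : ℍ[ℝ]} (hJ : J ∈ imagUnits) (a : ℂ) (N : ℕ) (z : ℂ) :
    symmKernel a N (slicePt J z) =
      slicePt J ((((1 - z * a) * (1 - z * conj a))⁻¹) ^ N) := by
  rw [symmKernel, slicePt_symm hJ, ← sliceHom_apply hJ, ← sliceHom_apply hJ, map_pow, map_inv₀]

theorem norm_one_sub_mul_pos {a z : ℂ} (ha : ‖a‖ < 1) (hz : ‖z‖ < 1) : 0 < ‖1 - z * a‖ := by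
  have := one_sub_norm_le_norm_one_sub_mul (a := a) hz.le
  linarith

theorem symm_ne_zero {a z : ℂ} (ha : ‖a‖ < 1) (hz : ‖z‖ < 1) :
    (1 - z * a) * (1 - z * conj a) ≠ 0 :=
  mul_ne_zero (norm_pos_iff.1 (norm_one_sub_mul_pos ha hz))
    (norm_pos_iff.1 (norm_one_sub_mul_pos (by rwa [RCLike.norm_conj]) hz))

theorem sliceRegularOn_symmKernel {a : ℂ} (ha : ‖a‖ < 1) (N : ℕ) :
    SliceRegularOn (symmKernel a N) unitBall := by
  refine ⟨fun q hq => DifferentiableAt.differentiableWithinAt ?_, fun J hJ x y hxy => ?_⟩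
  · have hne : 1 - (2 * a.re) • q + (‖a‖ ^ 2) • (q * q) ≠ 0 := by
      obtain ⟨J, hJ, hqJ⟩ := exists_slicePt q
      rw [hqJ, slicePt_mem_unitBall hJ] at hq
      rw [hqJ, slicePt_symm hJ, ← norm_ne_zero_iff, norm_slicePt hJ, norm_ne_zero_iff]
      exact symm_ne_zero ha hq
    have h1 : DifferentiableAt ℝ
        (fun q : ℍ[ℝ] => 1 - (2 * a.re) • q + (‖a‖ ^ 2) • (q * q)) q := by fun_prop
    exact (h1.inv hne).pow N
  · rw [slicePt_mem_unitBall hJ] at hxy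
    have h1 : DifferentiableAt ℂ
        (fun z : ℂ => (((1 - z * a) * (1 - z * conj a))⁻¹) ^ N) ⟨x, y⟩ :=
      ((show DifferentiableAt ℂ (fun z : ℂ => (1 - z * a) * (1 - z * conj a)) ⟨x, y⟩ by
        fun_prop).inv (symm_ne_zero ha hxy)).pow N
    have h2 := (hasFDerivAt_slicePt hJ _).comp (⟨x, y⟩ : ℂ)
      (h1.hasFDerivAt.restrictScalars ℝ)
    rw [dbar_eq_of_hasFDerivAt
      (h2.congr_of_eventuallyEq (.of_forall fun z => symmKernel_slicePt hJ a N z))]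
    set D := fderiv ℂ (fun z : ℂ => (((1 - z * a) * (1 - z * conj a))⁻¹) ^ N) ⟨x, y⟩
    have h4 : D Complex.I = Complex.I * D 1 := by
      rw [← smul_eq_mul, ← map_smul, smul_eq_mul, mul_one]
    have h5 : slicePt J Complex.I = J := by simp [slicePt]
    simp only [ContinuousLinearMap.comp_apply, ContinuousLinearMap.coe_restrictScalars', h4,
      LinearIsometry.coe_toContinuousLinearMap, sliceIsometry_apply, ← sliceHom_apply hJ]
    rw [map_mul, sliceHom_apply hJ Complex.I, h5, ← mul_assoc, imagUnits_mul_self hJ]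
    simp

theorem enorm_symmKernel_rpow {J : ℍ[ℝ]} (hJ : J ∈ imagUnits) (a : ℂ) (N : ℕ) {p : ℝ}
    (hp : 0 < p) (z : ℂ) :
    ‖symmKernel a N (slicePt J z)‖ₑ ^ p =
      ENNReal.ofReal ((‖1 - z * a‖ * ‖1 - z * conj a‖) ^ (-(N * p))) := by
  rw [symmKernel_slicePt hJ, ← ofReal_norm, norm_slicePt hJ, norm_pow, norm_inv, norm_mul,
    ENNReal.ofReal_rpow_of_nonneg (by positivity) hp.le, ← Real.rpow_natCast,
    ← Real.rpow_mul (by positivity), Real.inv_rpow (by positivity),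
    Real.rpow_neg (by positivity)]

theorem norm_sub_le_norm_one_sub_mul {a z : ℂ} (ha : ‖a‖ < 1) (hz : ‖z‖ < 1) :
    ‖z - a‖ ≤ ‖1 - z * conj a‖ := by
  refine le_of_sq_le_sq ?_ (norm_nonneg _)
  have h : ‖1 - z * conj a‖ ^ 2 - ‖z - a‖ ^ 2 = (1 - ‖a‖ ^ 2) * (1 - ‖z‖ ^ 2) := by
    rw [← Complex.normSq_eq_norm_sq, ← Complex.normSq_eq_norm_sq, ← Complex.normSq_eq_norm_sq,
      ← Complex.normSq_eq_norm_sq]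
    simp only [Complex.normSq_apply, Complex.sub_re, Complex.sub_im, Complex.mul_re,
      Complex.mul_im, Complex.conj_re, Complex.conj_im, Complex.one_re, Complex.one_im]
    ring
  have h1 : 0 ≤ 1 - ‖a‖ ^ 2 := by nlinarith [norm_nonneg a]
  have h2 : 0 ≤ 1 - ‖z‖ ^ 2 := by nlinarith [norm_nonneg z]
  nlinarith [mul_nonneg h1 h2]

/-- At every `z` one of the two factors of the kernel's denominator is therefore at least half of
`‖1 - a * a‖`. -/
theorem norm_one_sub_sq_le {a z : ℂ} (ha : ‖a‖ < 1) (hz : ‖z‖ < 1) :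
    ‖1 - a * a‖ ≤ ‖1 - z * a‖ + ‖1 - z * conj a‖ := by
  have e : 1 - a * a = (1 - z * a) + (z - a) * a := by ring
  rw [e]
  refine (norm_add_le _ _).trans ?_
  rw [norm_mul]
  have := norm_sub_le_norm_one_sub_mul ha hz
  nlinarith [norm_nonneg (z - a)]

theorem mul_rpow_neg_le {P Q E s : ℝ} (hP : 0 < P) (hQ : 0 < Q) (hE : 0 < E) (h : E ≤ P + Q)
    (hs : 0 ≤ s) : (P * Q) ^ (-s) ≤ (E / 2) ^ (-s) * (P ^ (-s) + Q ^ (-s)) := by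
  have hp := Real.rpow_nonneg hP.le (-s)
  have hq := Real.rpow_nonneg hQ.le (-s)
  have he := Real.rpow_nonneg (half_pos hE).le (-s)
  rw [Real.mul_rpow hP.le hQ.le]
  rcases le_total P Q with h1 | h1
  · have := Real.rpow_le_rpow_of_nonpos (half_pos hE) (by linarith : E / 2 ≤ Q)
      (neg_nonpos.2 hs)
    nlinarith
  · have := Real.rpow_le_rpow_of_nonpos (half_pos hE) (by linarith : E / 2 ≤ P)
      (neg_nonpos.2 hs)
    nlinarith

/-- Inside the disc `‖1 - z * conj a‖` is of order `1 - ‖a‖`, and `‖1 - z * a‖` is at most of order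
`‖1 - a * a‖`; each costs a factor `2 / (1 - r)`. -/
theorem norm_symm_le_of_pseudohyperbolic {a z : ℂ} {r : ℝ} (hr : r ∈ Set.Ioo (0 : ℝ) 1)
    (ha : ‖a‖ < 1) (h : ‖z - a‖ < r * ‖1 - z * conj a‖) :
    ‖1 - z * a‖ * ‖1 - z * conj a‖ ≤ 4 / (1 - r) ^ 2 * (‖1 - a * a‖ * (1 - ‖a‖)) := by
  have hr1 : 0 < 1 - r := by linarith [hr.2]
  have h1 := norm_one_sub_mul_conj_le (z := z) ha
  have h2 : ‖1 - z * conj a‖ * (1 - r) ≤ 2 * (1 - ‖a‖) := by nlinarith [norm_nonneg a]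
  have h3 : ‖1 - z * a‖ ≤ ‖1 - a * a‖ + ‖z - a‖ := by
    have e : 1 - z * a = (1 - a * a) - (z - a) * a := by ring
    rw [e]
    refine (norm_sub_le _ _).trans ?_
    rw [norm_mul]
    nlinarith [norm_nonneg (z - a)]
  have h4 : 1 - ‖a‖ ≤ ‖1 - a * a‖ := one_sub_norm_le_norm_one_sub_mul ha.le
  have h5 : ‖1 - z * a‖ * (1 - r) ≤ 2 * ‖1 - a * a‖ := by
    have : r * (‖1 - z * conj a‖ * (1 - r)) ≤ r * (2 * (1 - ‖a‖)) :=
      mul_le_mul_of_nonneg_left h2 hr.1.le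
    nlinarith [hr.1, hr.2]
  rw [div_mul_eq_mul_div, le_div_iff₀ (by positivity)]
  calc _ = (‖1 - z * a‖ * (1 - r)) * (‖1 - z * conj a‖ * (1 - r)) := by ring
    _ ≤ (2 * ‖1 - a * a‖) * (2 * (1 - ‖a‖)) := by gcongr
    _ = _ := by ring

/-- The larger factor is bounded below by `‖1 - a * a‖ / 2`; the other is integrated by the
Forelli-Rudin estimate. -/
theorem exists_lintegral_symmKernel_le {p : ℝ} (hp : 0 < p) {N : ℕ} (hN : 2 < N * p) :
    ∃ K : ℝ≥0, ∀ a : ℂ, ‖a‖ < 1 → ∀ I ∈ imagUnits,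
      ∫⁻ z in ball (0 : ℂ) 1, ‖symmKernel a N (slicePt I z)‖ₑ ^ p ≤
        K * ENNReal.ofReal ((‖1 - a * a‖ / 2) ^ (-(N * p)) * (1 - ‖a‖) ^ (2 - N * p)) := by
  obtain ⟨K, hK⟩ := exists_lintegral_norm_one_sub_mul_rpow_le hN
  refine ⟨2 * K, fun a ha I hI => ?_⟩
  set s := N * p with hs
  have hc : ‖conj a‖ = ‖a‖ := RCLike.norm_conj a
  have hE : 0 < ‖1 - a * a‖ := norm_one_sub_mul_pos ha ha
  have h1 := hK a ha
  have h2 := hK (conj a) (hc.trans_lt ha)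
  rw [hc] at h2
  have hpt : ∀ z ∈ ball (0 : ℂ) 1, ‖symmKernel a N (slicePt I z)‖ₑ ^ p ≤
      ENNReal.ofReal ((‖1 - a * a‖ / 2) ^ (-s)) * (ENNReal.ofReal (‖1 - z * a‖ ^ (-s)) +
        ENNReal.ofReal (‖1 - z * conj a‖ ^ (-s))) := by
    intro z hz
    rw [mem_ball_zero_iff] at hz
    rw [enorm_symmKernel_rpow hI a N hp, ← ENNReal.ofReal_add (by positivity) (by positivity),
      ← ENNReal.ofReal_mul (by positivity)]
    exact ENNReal.ofReal_le_ofReal (mul_rpow_neg_le (norm_one_sub_mul_pos ha hz)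
      (norm_one_sub_mul_pos (hc.trans_lt ha) hz) hE (norm_one_sub_sq_le ha hz) (by linarith))
  calc _ ≤ ∫⁻ z in ball (0 : ℂ) 1, ENNReal.ofReal ((‖1 - a * a‖ / 2) ^ (-s)) *
          (ENNReal.ofReal (‖1 - z * a‖ ^ (-s)) + ENNReal.ofReal (‖1 - z * conj a‖ ^ (-s))) :=
        setLIntegral_mono' measurableSet_ball hpt
    _ = ENNReal.ofReal ((‖1 - a * a‖ / 2) ^ (-s)) *
          ((∫⁻ z in ball (0 : ℂ) 1, ENNReal.ofReal (‖1 - z * a‖ ^ (-s))) +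
            ∫⁻ z in ball (0 : ℂ) 1, ENNReal.ofReal (‖1 - z * conj a‖ ^ (-s))) := by
        rw [lintegral_const_mul' _ _ ENNReal.ofReal_ne_top, lintegral_add_left (by fun_prop)]
    _ ≤ ENNReal.ofReal ((‖1 - a * a‖ / 2) ^ (-s)) *
          (K * ENNReal.ofReal ((1 - ‖a‖) ^ (2 - s)) + K * ENNReal.ofReal ((1 - ‖a‖) ^ (2 - s))) := by
        gcongr
    _ = _ := by
        rw [ENNReal.ofReal_mul (by positivity), ENNReal.coe_mul, ← two_mul, ENNReal.coe_ofNat]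
        ring

/-! ### From the Carleson inequality to the tube bound -/

variable [MeasurableSpace ℍ[ℝ]] [BorelSpace ℍ[ℝ]]

theorem IsCarleson.tubeBound {p : ℝ} (hp : 0 < p) {μ : Measure ℍ[ℝ]}
    (hμ : μ unitBallᶜ = 0) (h : IsCarleson p μ) {r : ℝ} (hr : r ∈ Set.Ioo (0 : ℝ) 1) :
    TubeBound μ r := by
  obtain ⟨C, hC⟩ := h
  obtain ⟨N, hN⟩ := exists_nat_gt (2 / p)
  rw [div_lt_iff₀ hp] at hN
  obtain ⟨K, hK⟩ := exists_lintegral_symmKernel_le hp hN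
  have hr0 := hr.1
  have hr1 : 0 < 1 - r := by linarith [hr.2]
  set s := N * p with hs
  refine ⟨C * K * Real.toNNReal ((8 / (1 - r) ^ 2) ^ s / (r ^ 2 * Real.pi)),
    fun I hI α hα => ?_⟩
  obtain ⟨a, ha, rfl⟩ := (mem_sliceBall hI).1 hα
  set E := ‖1 - a * a‖ with hE
  set δ := 1 - ‖a‖ with hδ
  have hE0 : 0 < E := norm_one_sub_mul_pos ha ha
  have hδ0 : 0 < δ := by linarith
  have hreg := sliceRegularOn_symmKernel ha N
  set f := symmKernel a N with hf
  have hsup : ⨆ J ∈ imagUnits, ∫⁻ z in ball (0 : ℂ) 1, ‖f (slicePt J z)‖ₑ ^ p ≤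
      K * ENNReal.ofReal ((E / 2) ^ (-s) * δ ^ (2 - s)) := iSup₂_le fun J hJ => hK a ha J hJ
  have hmem : MemBergman p f := by
    refine ⟨hreg, lt_of_le_of_lt (le_of_eq ?_) (hsup.trans_lt
      (ENNReal.mul_lt_top ENNReal.coe_lt_top ENNReal.ofReal_lt_top))⟩
    exact iSup_congr fun I => iSup_congr fun hI => setLIntegral_sliceBall hI _
  have h1 := hC f hmem
  rw [bergmanNorm_rpow hp] at h1
  replace h1 := h1.trans (mul_le_mul_right hsup C)
  have hμr : μ.restrict unitBall = μ := Measure.restrict_eq_self_of_ae_mem hμ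
  -- Lower bound for `‖f‖ ^ p` on the tube.
  set m : ℝ := (4 / (1 - r) ^ 2 * (E * δ)) ^ (-s) with hm
  have hm0 : 0 < m := by positivity
  have hsub : tube I (slicePt I a) r ⊆ {q | ENNReal.ofReal m ≤ ‖f q‖ₑ ^ p} := by
    intro q hq
    obtain ⟨J, hJ, z, rfl, hz, hza⟩ := exists_of_mem_tube hI ha hq
    rw [Set.mem_ofPred_eq, hf, enorm_symmKernel_rpow hJ a N hp]
    refine ENNReal.ofReal_le_ofReal (Real.rpow_le_rpow_of_nonpos ?_
      (norm_symm_le_of_pseudohyperbolic hr ha hza) (by linarith))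
    exact mul_pos (norm_one_sub_mul_pos ha hz)
      (norm_one_sub_mul_pos (by rwa [RCLike.norm_conj]) hz)
  have hfm : AEMeasurable (fun q => ‖f q‖ₑ ^ p) μ := by
    rw [← hμr]
    exact (ENNReal.continuous_rpow_const.comp_continuousOn
      hreg.1.continuousOn.enorm).aemeasurable isOpen_unitBall.measurableSet
  have h2 : ENNReal.ofReal m * μ (tube I (slicePt I a) r) ≤
      C * (K * ENNReal.ofReal ((E / 2) ^ (-s) * δ ^ (2 - s))) := by
    calc _ ≤ ENNReal.ofReal m * μ {q | ENNReal.ofReal m ≤ ‖f q‖ₑ ^ p} := by gcongr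
      _ ≤ ∫⁻ q, ‖f q‖ₑ ^ p ∂μ := mul_meas_ge_le_lintegral₀ hfm _
      _ = ∫⁻ q in unitBall, ‖f q‖ₑ ^ p ∂μ := by rw [hμr]
      _ ≤ _ := h1
  -- The powers of `E` cancel and `δ ^ 2` remains, rewritten as a multiple of the area of the
  -- inscribed Euclidean disc of radius `r * δ`.
  have h3 : m⁻¹ * ((E / 2) ^ (-s) * δ ^ (2 - s)) =
      (8 / (1 - r) ^ 2) ^ s / (r ^ 2 * Real.pi) * ((r * δ) ^ 2 * Real.pi) := by
    have e1 : m⁻¹ = (8 / (1 - r) ^ 2) ^ s * (E / 2) ^ s * δ ^ s := by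
      rw [hm, Real.rpow_neg (by positivity), inv_inv, ← Real.mul_rpow (by positivity)
        (by positivity), ← Real.mul_rpow (by positivity) (by positivity)]
      congr 1
      ring
    have e2 : (E / 2) ^ s * (E / 2) ^ (-s) = 1 := by
      rw [← Real.rpow_add (by positivity)]; simp
    have e3 : δ ^ s * δ ^ (2 - s) = δ ^ 2 := by
      rw [← Real.rpow_add hδ0, ← Real.rpow_natCast]; congr 1; push_cast; ring
    calc _ = (8 / (1 - r) ^ 2) ^ s * ((E / 2) ^ s * (E / 2) ^ (-s)) * (δ ^ s * δ ^ (2 - s)) := by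
          rw [e1]; ring
      _ = (8 / (1 - r) ^ 2) ^ s * δ ^ 2 := by rw [e2, e3, mul_one]
      _ = _ := by
          have := Real.pi_pos
          field_simp
  have hpi : (NNReal.pi : ℝ≥0∞) = ENNReal.ofReal Real.pi := by
    rw [← NNReal.coe_real_pi, ENNReal.ofReal_coe_nnreal]
  calc μ (tube I (slicePt I a) r)
      = ENNReal.ofReal m⁻¹ * (ENNReal.ofReal m * μ (tube I (slicePt I a) r)) := by
        rw [← mul_assoc, ← ENNReal.ofReal_mul (by positivity), inv_mul_cancel₀ hm0.ne',
          ENNReal.ofReal_one, one_mul]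
    _ ≤ ENNReal.ofReal m⁻¹ * (C * (K * ENNReal.ofReal ((E / 2) ^ (-s) * δ ^ (2 - s)))) := by
        gcongr
    _ = C * K * (ENNReal.ofReal m⁻¹ * ENNReal.ofReal ((E / 2) ^ (-s) * δ ^ (2 - s))) := by ring
    _ = C * K * (ENNReal.ofReal ((8 / (1 - r) ^ 2) ^ s / (r ^ 2 * Real.pi)) *
          (ENNReal.ofReal (r * δ) ^ 2 * NNReal.pi)) := by
        rw [← ENNReal.ofReal_mul (by positivity), h3, ENNReal.ofReal_mul (by positivity),
          ENNReal.ofReal_mul (by positivity), ENNReal.ofReal_pow (by positivity), hpi]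
    _ ≤ C * K * (ENNReal.ofReal ((8 / (1 - r) ^ 2) ^ s / (r ^ 2 * Real.pi)) *
          sliceArea I (discSlice I (slicePt I a) r)) := by
        gcongr
        exact le_sliceArea_discSlice hI ha hr
    _ = _ := by
        push_cast
        rw [← mul_assoc]
        rfl

end SliceBergman

theorem mainTheorem2 [MeasurableSpace ℍ[ℝ]] [BorelSpace ℍ[ℝ]]
    (p : ℝ) (hp : 0 < p)
    (μ : Measure ℍ[ℝ]) [IsFiniteMeasure μ] (hμ : μ SliceBergman.unitBallᶜ = 0) :
    List.TFAE
      [SliceBergman.IsCarleson p μ,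
       ∀ r ∈ Set.Ioo (0 : ℝ) 1, SliceBergman.TubeBound μ r,
       ∃ r ∈ Set.Ioo (0 : ℝ) 1, SliceBergman.TubeBound μ r] := by
  tfae_have 1 → 2 := fun h r hr => h.tubeBound hp hμ hr
  tfae_have 2 → 3 := fun h => ⟨1 / 2, by norm_num, h _ (by norm_num)⟩
  tfae_have 3 → 1 := fun ⟨r, hr, h⟩ => SliceBergman.isCarleson_of_tubeBound hp hr h
  tfae_finish
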